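/- Let $n,m\ge 0$ be integers, $\mathbb T=\mathbb R/\mathbb Z$, and let $X=\mathbb T^n\times\mathbb R^m$ carry the product of the Lebesgue measures. A *weight* is a measurable function $X\to(0,\infty)$. For $t>0$ let $$\phi^{WG}_t(x,y)=(4\pi t)^{-\frac{n+m}{2}}\sum_{k\in\mathbb Z^n}e^{-\frac{|x+k|^2+|y|^2}{4t}},\qquad (x,y)\in X,$$ and let $\phi_t^{WG}*f(z)=\int_X\phi_t^{WG}(z-z')f(z')\,dz'$; this is called finite at $z$ if the integral converges absolutely. For $R>0$ put $$W_R^*f(z)=\sup_{0<t<R}\left|\phi^{WG}_t*f(z)\right|\in[0,\infty],$$ where $|\phi^{WG}_t*f(z)|:=\infty$ if the integral does not converge absolutely. For $1\le p<\infty$ and a weight $w$ let $\|g\|_{L^p_w}=\|g\,w^{1/p}\|_{L^p(X)}$, and let $L^p_w$ be the space of measurable $f:X\to\mathbb C$ with $\|f\|_{L^p_w}<\infty$. Let $1/p+1/p'=1$ ($p'=\infty$ if $p=1$). A weight $v$ belongs to $D^{WG}_p$ if there is $t_0>0$ such that the function $v(x,y)^{-1/p}e^{-|y|^2/(4t_0)}$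 is in $L^{p'}(X)$. **Theorem 4.5.** Let $1\le p<\infty$ and let $v$ be a weight on $X$. The following are equivalent: 1. $v\in D^{WG}_p$. 2. There exist $0<R<\frac12$ and a weight $u$ such that $W_R^*$ is bounded from $L^p_v$ into $L^p_u$ if $p>1$, and from $L^1_v$ into weak $L^1_u$ if $p=1$. That is, there is a constant $C<\infty$ such that for all $f\in L^p_v$: $\|W_R^*f\|_{L^p_u}\le C\|f\|_{L^p_v}$ if $p>1$, and $\int_{\{W_R^*f>s\}}u\,dz\le \frac Cs\|f\|_{L^1_v}$ for all $s>0$ if $p=1$. 3. There exists $0<R<\frac12$ such that for every $f\in L^p_v$ the convolution $\phi^{WG}_R*f$ is finite almost everywhere and $\lim_{t\to0^+}\phi^{WG}_t*f(x,y)=f(x,y)$ for almost every $(x,y)\in X$. 4. There exists $0<R<\frac12$ such that for every $f\in L^p_v$, $W_R^*f(x,y)<\infty$ for almost every $(x,y)\in X$. -/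

import Mathlib

open MeasureTheory Filter Topology Set
open scoped ENNReal NNReal

noncomputable section

/-- The waveguide `𝕋ⁿ × ℝᵐ`, with `𝕋 = ℝ/ℤ` and `ℝᵐ` Euclidean. Its `volume` is the product of the
Lebesgue measure of `𝕋ⁿ` (total mass `1`) and the Lebesgue measure of `ℝᵐ`. -/
abbrev Waveguide (n m : ℕ) : Type :=
  UnitAddTorus (Fin n) × EuclideanSpace ℝ (Fin m)

namespace Waveguide

variable {n m : ℕ}

/-- The representative of a point of `ℝ/ℤ` in `[-1/2, 1/2)`. -/
def rep (x : UnitAddCircle) : ℝ := (AddCircle.equivIco (1 : ℝ) (-1 / 2) x : ℝ)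

/-- The heat kernel of `𝕋ⁿ × ℝᵐ` at time `t`:
`(4πt)^(-(n+m)/2) ∑_{k ∈ ℤⁿ} exp (-(|x + k|² + |y|²) / (4t))`. -/
def heatKernel (t : ℝ) (z : Waveguide n m) : ℝ :=
  (4 * Real.pi * t) ^ (-(((n : ℝ) + m) / 2)) *
    ∑' k : Fin n → ℤ, Real.exp (-((∑ i, (rep (z.1 i) + k i) ^ 2) + ‖z.2‖ ^ 2) / (4 * t))

lemma coe_rep (x : UnitAddCircle) : (rep x : UnitAddCircle) = x :=
  (AddCircle.equivIco (1 : ℝ) (-1 / 2)).symm_apply_apply x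

/-- The heat kernel may be computed with any real representatives of the torus coordinates. -/
theorem heatKernel_coe (t : ℝ) (x : Fin n → ℝ) (y : EuclideanSpace ℝ (Fin m)) :
    heatKernel t ((fun i => (x i : UnitAddCircle)), y) =
      (4 * Real.pi * t) ^ (-(((n : ℝ) + m) / 2)) *
        ∑' k : Fin n → ℤ, Real.exp (-((∑ i, (x i + k i) ^ 2) + ‖y‖ ^ 2) / (4 * t)) := by
  have h : ∀ i, ∃ j : ℤ, rep (x i : UnitAddCircle) = x i + j := by
    intro i
    have := coe_rep (x i : UnitAddCircle)
    rw [← sub_eq_zero, ← AddCircle.coe_sub, AddCircle.coe_eq_zero_iff] at this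
    obtain ⟨j, hj⟩ := this
    refine ⟨j, ?_⟩
    simp only [zsmul_eq_mul, mul_one] at hj
    linarith
  choose j hj using h
  unfold heatKernel
  congr 1
  rw [← (Equiv.addLeft j).tsum_eq (fun k : Fin n → ℤ =>
    Real.exp (-((∑ i, (x i + k i) ^ 2) + ‖y‖ ^ 2) / (4 * t)))]
  refine tsum_congr fun k => ?_
  simp only [hj, Equiv.coe_addLeft, Pi.add_apply, Int.cast_add, add_assoc]

/-- The integral defining `(φ_t * f)(z)` converges (absolutely), i.e. `(φ_t * f)(z)` is finite. -/
def HeatConvFinite (t : ℝ) (f : Waveguide n m → ℂ) (z : Waveguide n m) : Prop :=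
  Integrable (fun z' => (heatKernel t (z - z') : ℂ) * f z') volume

/-- The convolution `(φ_t * f)(z) = ∫ φ_t(z - z') f(z') dz'` on `𝕋ⁿ × ℝᵐ`
(meaningful where `HeatConvFinite t f z`). -/
def heatConv (t : ℝ) (f : Waveguide n m → ℂ) (z : Waveguide n m) : ℂ :=
  ∫ z', (heatKernel t (z - z') : ℂ) * f z'

open Classical in
/-- `|φ_t * f(z)|` as an element of `[0, ∞]`, equal to `∞` where the integral does not converge. -/
def absHeatConv (t : ℝ) (f : Waveguide n m → ℂ) (z : Waveguide n m) : ℝ≥0∞ :=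
  if HeatConvFinite t f z then ‖heatConv t f z‖ₑ else ∞

/-- The local maximal operator `W*_R f(z) = sup_{0 < t < R} |φ_t * f(z)|`. -/
def heatMaximal (R : ℝ) (f : Waveguide n m → ℂ) (z : Waveguide n m) : ℝ≥0∞ :=
  ⨆ t ∈ Ioo (0 : ℝ) R, absHeatConv t f z

/-- A strictly positive (finite, measurable) weight. -/
structure IsWeight (w : Waveguide n m → ℝ) : Prop where
  measurable : Measurable w
  pos : ∀ z, 0 < w z

/-- The weighted norm `‖g w^{1/p}‖_{L^p}` of a `[0, ∞]`-valued function `g`. -/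
def wLpNorm (p : ℝ) (w : Waveguide n m → ℝ) (g : Waveguide n m → ℝ≥0∞) : ℝ≥0∞ :=
  eLpNorm (fun z => g z * ENNReal.ofReal (w z ^ (1 / p))) (ENNReal.ofReal p) volume

/-- Membership in the weighted Lebesgue space `L^p_w(𝕋ⁿ × ℝᵐ)`. -/
def MemWLp (p : ℝ) (w : Waveguide n m → ℝ) (f : Waveguide n m → ℂ) : Prop :=
  AEStronglyMeasurable f volume ∧ wLpNorm p w (fun z => ‖f z‖ₑ) < ∞

/-- The class `D^{WG}_p`: for some `t₀ > 0` the function `v^{-1/p} e^{-|y|²/(4t₀)}` is in `L^{p'}`,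
where `1/p + 1/p' = 1` (so `p' = ∞` for `p = 1`). -/
def MemDWG (p : ℝ) (v : Waveguide n m → ℝ) : Prop :=
  ∃ t₀ : ℝ, 0 < t₀ ∧
    MemLp (fun z : Waveguide n m => v z ^ (-(1 / p)) * Real.exp (-‖z.2‖ ^ 2 / (4 * t₀)))
      (ENNReal.conjExponent (ENNReal.ofReal p)) volume

/-- `W*_R` is bounded from `L^p_v` into `L^p_u`. -/
def MaximalStrongType (p R : ℝ) (v u : Waveguide n m → ℝ) : Prop :=
  ∃ C : ℝ≥0, ∀ f : Waveguide n m → ℂ, MemWLp p v f →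
    wLpNorm p u (heatMaximal R f) ≤ C * wLpNorm p v (fun z => ‖f z‖ₑ)

/-- `W*_R` is bounded from `L^1_v` into weak `L^1_u`:
`u {W*_R f > s} ≤ (C / s) ‖f‖_{L^1_v}` for all `s > 0`. -/
def MaximalWeakType (R : ℝ) (v u : Waveguide n m → ℝ) : Prop :=
  ∃ C : ℝ≥0, ∀ f : Waveguide n m → ℂ, MemWLp 1 v f → ∀ s : ℝ, 0 < s →
    ∫⁻ z in {z | ENNReal.ofReal s < heatMaximal R f z}, ENNReal.ofReal (u z)
      ≤ C / ENNReal.ofReal s * wLpNorm 1 v (fun z => ‖f z‖ₑ)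

end Waveguide

end

/-! Sufficiency rests on maximal inequalities for arbitrary measures. By the Besicovitch covering
theorem, the centered maximal function of a measure on Euclidean space is of weak type (1,1) and, by
interpolation, of strong type (p,p), with constants independent of the measure (`exists_weakType`,
`exists_strongType`). A Gaussian is a superposition of indicators of balls, so Gaussian averages
against any measure that is finite on balls are bounded by its maximal function times the Gaussian
mass. On the waveguide the heat kernel is comparable, for bounded times, with finitely many
Gaussians centered at lifts to neighbouring cells of the universal cover, and so the bounds descend
(`lintegral_eKernel_mul_le`).

Hölder's inequality and the class `MemDWG` put `|f| e^{-a|y|²}` in `L¹`. For small times the growth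
`e^{a|y'|²}` can be moved to the center `z` at the price of doubling the time, which yields a
majorant of the maximal operator that is finite almost everywhere
(`lintegral_eKernel_mul_le_majorant`). This gives finiteness and, with a Lebesgue point argument on
the cover, almost everywhere convergence. For `p = 1` the majorant is of weak type apart from a
locally bounded factor, which a suitable `u` absorbs.

For `p > 1` put `σ = v^{-1/(p-1)}`, `ν = σ dz` and `|f| = σ g`. Heat averages of `|f|` are at most
`A · M_ν g · D`, where `D` is the majorant for `σ`, so `u = σ/(1+D)^p` reduces the claim to the
strong type bound for `M_ν`, because `∫ g^p dν = ∫ |f|^p v`.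

Conversely, each of the other conditions makes one heat average at a fixed time finite at some point
for every `f` in `L^p_v`. From a fixed center the kernel dominates a multiple of `e^{-|y'|²/(2t)}`,
so `v^{-1/p} e^{-|y|²/(2t)}` pairs finitely with all of `L^p`; a gliding hump argument and the
converse of Hölder's inequality place it in `L^{p'}` (`memDWG_of_exists_lintegral_lt_top`). -/

noncomputable section

/-! ### Centered maximal functions of arbitrary measures. -/

namespace CenteredMaximal

variable {α : Type*} [MetricSpace α] [MeasurableSpace α]

/-- The centered Hardy--Littlewood maximal function of `f` with respect to `μ`, taken over closed
balls of positive rational radius. -/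
def maximal (μ : Measure α) (f : α → ℝ≥0∞) (x : α) : ℝ≥0∞ :=
  ⨆ q : {q : ℚ // 0 < q},
    (∫⁻ y in Metric.closedBall x (q : ℚ), f y ∂μ) / μ (Metric.closedBall x (q : ℚ))

section Measurability

variable [BorelSpace α] [SecondCountableTopology α]

lemma measurable_lintegral_closedBall (μ : Measure α) [SFinite μ] {f : α → ℝ≥0∞}
    (hf : Measurable f) (r : ℝ) :
    Measurable fun x => ∫⁻ y in Metric.closedBall x r, f y ∂μ := by
  have hs : MeasurableSet {p : α × α | dist p.2 p.1 ≤ r} :=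
    measurableSet_le (measurable_snd.dist measurable_fst) measurable_const
  have : ∀ x, ∫⁻ y in Metric.closedBall x r, f y ∂μ =
      ∫⁻ y, {p : α × α | dist p.2 p.1 ≤ r}.indicator (fun p => f p.2) (x, y) ∂μ := by
    intro x
    rw [← lintegral_indicator Metric.isClosed_closedBall.measurableSet]
    rfl
  simp_rw [this]
  exact Measurable.lintegral_prod_right ((hf.comp measurable_snd).indicator hs)

lemma measurable_maximal (μ : Measure α) [SFinite μ] {f : α → ℝ≥0∞} (hf : Measurable f) :
    Measurable (maximal μ f) := by
  refine Measurable.iSup fun q => (measurable_lintegral_closedBall μ hf _).div ?_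
  simpa using measurable_lintegral_closedBall μ (measurable_const (a := (1 : ℝ≥0∞))) ((q : ℚ) : ℝ)

end Measurability

/-- The maximal function controls averages over balls of arbitrary radius. -/
lemma lintegral_closedBall_le [OpensMeasurableSpace α] {μ : Measure α}
    (hμ : ∀ x r, μ (Metric.closedBall x r) < ∞)
    (f : α → ℝ≥0∞) (x : α) {r : ℝ} (hr : 0 ≤ r) :
    ∫⁻ y in Metric.closedBall x r, f y ∂μ ≤ maximal μ f x * μ (Metric.closedBall x r) := by
  by_cases h0 : μ (Metric.closedBall x r) = 0
  · rw [Measure.restrict_eq_zero.2 h0]; simp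
  by_cases hM : maximal μ f x = ∞
  · rw [hM, ENNReal.top_mul h0]; exact le_top
  -- Rational radii decreasing to `r` suffice: the measure of closed balls is continuous from above.
  obtain ⟨u, hu_anti, hu_gt, hu_lim⟩ := Real.exists_seq_rat_strictAnti_tendsto r
  have hlim : Tendsto (fun k => μ (Metric.closedBall x (u k))) atTop
      (𝓝 (μ (Metric.closedBall x r))) := by
    have h1 : Metric.closedBall x r = ⋂ k, Metric.closedBall x (u k : ℝ) := by
      ext y
      simp only [Metric.mem_closedBall, mem_iInter]
      exact ⟨fun h k => h.trans (hu_gt k).le, fun h => ge_of_tendsto' hu_lim h⟩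
    rw [h1]
    refine tendsto_measure_iInter_atTop
      (fun k => Metric.isClosed_closedBall.measurableSet.nullMeasurableSet) ?_ ⟨0, (hμ _ _).ne⟩
    intro i j hij
    exact Metric.closedBall_subset_closedBall (by exact_mod_cast hu_anti.antitone hij)
  refine ge_of_tendsto' (ENNReal.Tendsto.const_mul hlim (Or.inr hM)) fun k => ?_
  have hpos : 0 < u k := by
    have := hr.trans_lt (hu_gt k)
    exact_mod_cast this
  calc ∫⁻ y in Metric.closedBall x r, f y ∂μ
      ≤ ∫⁻ y in Metric.closedBall x (u k), f y ∂μ :=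
        lintegral_mono_set (Metric.closedBall_subset_closedBall (hu_gt k).le)
    _ ≤ maximal μ f x * μ (Metric.closedBall x (u k)) := by
        have h2 : (∫⁻ y in Metric.closedBall x (u k), f y ∂μ) / μ (Metric.closedBall x (u k))
            ≤ maximal μ f x :=
          le_iSup (fun q : {q : ℚ // 0 < q} => (∫⁻ y in Metric.closedBall x (q : ℚ), f y ∂μ) /
            μ (Metric.closedBall x (q : ℚ))) ⟨u k, hpos⟩
        refine (ENNReal.div_le_iff_le_mul (Or.inl fun h => h0 ?_) (Or.inl (hμ _ _).ne)).1 h2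
        exact measure_mono_null (Metric.closedBall_subset_closedBall (hu_gt k).le) h

/-- The weak type (1,1) bound for the centered maximal function, with a constant that depends only
on the space. -/
theorem exists_weakType (α : Type*) [MetricSpace α] [MeasurableSpace α] [OpensMeasurableSpace α]
    [SecondCountableTopology α] [HasBesicovitchCovering α] :
    ∃ N : ℕ, ∀ (μ : Measure α) (f : α → ℝ≥0∞) (s : ℝ≥0∞),
      s * μ {x | s < maximal μ f x} ≤ N * ∫⁻ x, f x ∂μ := by
  obtain ⟨N, τ, hτ, hN⟩ := HasBesicovitchCovering.no_satelliteConfig (α := α)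
  refine ⟨N, fun μ f s => ?_⟩
  -- The covering theorem needs bounded radii, hence the exhaustion by `q ≤ j`.
  set A : ℕ → Set α := fun j => {x | ∃ q : ℚ, 0 < q ∧ (q : ℝ) ≤ j ∧
    s * μ (Metric.closedBall x q) ≤ ∫⁻ y in Metric.closedBall x q, f y ∂μ} with hA
  have hsub : {x | s < maximal μ f x} ⊆ ⋃ j, A j := by
    intro x hx
    obtain ⟨⟨q, hq⟩, h⟩ := lt_iSup_iff.1 (show s < maximal μ f x from hx)
    obtain ⟨j, hj⟩ := exists_nat_ge (q : ℝ)
    exact mem_iUnion.2 ⟨j, q, hq, hj, ENNReal.mul_le_of_le_div h.le⟩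
  have hmono : Monotone A := by
    rintro i j hij x ⟨q, h1, h2, h3⟩
    exact ⟨q, h1, h2.trans (by exact_mod_cast hij), h3⟩
  have key : ∀ j, s * μ (A j) ≤ N * ∫⁻ x, f x ∂μ := by
    intro j
    choose! r hr0 hrj hr using fun (x : α) (hx : x ∈ A j) => hx
    let Q : Besicovitch.BallPackage (A j) α :=
      { c := fun b => b, r := fun b => r b, rpos := fun b => by exact_mod_cast hr0 b b.2,
        r_bound := j, r_le := fun b => hrj b b.2 }
    obtain ⟨t, ht_disj, ht_cov⟩ := Besicovitch.exist_disjoint_covering_families hτ hN Q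
    have hcount : ∀ i, (t i).Countable := fun i =>
      (ht_disj i).countable_of_nonempty_interior fun b _ =>
        (Metric.nonempty_ball.2 (Q.rpos b)).mono Metric.ball_subset_interior_closedBall
    have hAcov : A j ⊆ ⋃ i : Fin N, ⋃ b ∈ t i, Metric.closedBall (Q.c b) (Q.r b) := by
      intro x hx
      have := ht_cov ⟨⟨x, hx⟩, rfl⟩
      simp only [mem_iUnion] at this ⊢
      obtain ⟨i, b, hb, h⟩ := this
      exact ⟨i, b, hb, Metric.ball_subset_closedBall h⟩
    have hfam : ∀ i, s * μ (⋃ b ∈ t i, Metric.closedBall (Q.c b) (Q.r b)) ≤ ∫⁻ x, f x ∂μ := by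
      intro i
      calc s * μ (⋃ b ∈ t i, Metric.closedBall (Q.c b) (Q.r b))
          ≤ s * ∑' b : t i, μ (Metric.closedBall (Q.c b) (Q.r b)) := by
            gcongr; exact measure_biUnion_le μ (hcount i) _
        _ = ∑' b : t i, s * μ (Metric.closedBall (Q.c b) (Q.r b)) := ENNReal.tsum_mul_left.symm
        _ ≤ ∑' b : t i, ∫⁻ y in Metric.closedBall (Q.c b) (Q.r b), f y ∂μ :=
            ENNReal.tsum_le_tsum fun b => hr b b.1.2
        _ = ∫⁻ y in ⋃ b ∈ t i, Metric.closedBall (Q.c b) (Q.r b), f y ∂μ :=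
            (lintegral_biUnion (hcount i) (fun b _ => Metric.isClosed_closedBall.measurableSet)
              (ht_disj i) f).symm
        _ ≤ ∫⁻ x, f x ∂μ := setLIntegral_le_lintegral _ _
    calc s * μ (A j) ≤ s * ∑ i : Fin N, μ (⋃ b ∈ t i, Metric.closedBall (Q.c b) (Q.r b)) := by
          gcongr
          exact (measure_mono hAcov).trans (measure_iUnion_fintype_le _ _)
      _ = ∑ i : Fin N, s * μ (⋃ b ∈ t i, Metric.closedBall (Q.c b) (Q.r b)) := Finset.mul_sum _ _ _
      _ ≤ ∑ _i : Fin N, ∫⁻ x, f x ∂μ := Finset.sum_le_sum fun i _ => hfam i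
      _ = N * ∫⁻ x, f x ∂μ := by simp
  calc s * μ {x | s < maximal μ f x} ≤ s * μ (⋃ j, A j) := by gcongr
    -- Continuity from below along a monotone union needs no measurability of `A j`.
    _ = ⨆ j, s * μ (A j) := by rw [hmono.measure_iUnion, ENNReal.mul_iSup]
    _ ≤ _ := iSup_le key

/-- Layer cake formula for extended nonnegative numbers. -/
lemma rpow_eq_lintegral_indicator {q : ℝ} (hq : 0 < q) (a : ℝ≥0∞) :
    a ^ q = ∫⁻ t in Ioi (0 : ℝ), ENNReal.ofReal (q * t ^ (q - 1)) *
      (if ENNReal.ofReal t < a then 1 else 0) := by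
  have hfin : ∀ b : ℝ, 0 ≤ b → ENNReal.ofReal b ^ q =
      ∫⁻ t in Ioi (0 : ℝ), ENNReal.ofReal (q * t ^ (q - 1)) *
        (if ENNReal.ofReal t < ENNReal.ofReal b then 1 else 0) := by
    intro b hb
    have h1 : ∀ t ∈ Ioi (0 : ℝ), ENNReal.ofReal (q * t ^ (q - 1)) *
        (if ENNReal.ofReal t < ENNReal.ofReal b then 1 else 0) =
        (Iio b).indicator (fun t => ENNReal.ofReal (q * t ^ (q - 1))) t := by
      intro t ht
      by_cases h : t < b
      · simp [h, ENNReal.ofReal_lt_ofReal_iff (lt_of_le_of_lt (le_of_lt ht) h)]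
      · have : ¬ ENNReal.ofReal t < ENNReal.ofReal b :=
          not_lt.2 (ENNReal.ofReal_le_ofReal (not_lt.1 h))
        simp [h, this]
    rw [setLIntegral_congr_fun measurableSet_Ioi h1, setLIntegral_indicator measurableSet_Iio,
      Iio_inter_Ioi, Measure.restrict_congr_set Ioo_ae_eq_Ioc]
    rw [← ofReal_integral_eq_lintegral_ofReal, ← intervalIntegral.integral_of_le hb,
      intervalIntegral.integral_const_mul, integral_rpow (Or.inl (by linarith))]
    · rw [sub_add_cancel, Real.zero_rpow hq.ne', sub_zero, mul_div_cancel₀ _ hq.ne',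
        ENNReal.ofReal_rpow_of_nonneg hb hq.le]
    · have := (intervalIntegral.intervalIntegrable_rpow' (a := 0) (b := b)
        (r := q - 1) (by linarith)).const_mul q
      exact (intervalIntegrable_iff_integrableOn_Ioc_of_le hb).1 this
    · filter_upwards [ae_restrict_mem measurableSet_Ioc] with t ht
      have := ht.1.le
      positivity
  -- For `a = ∞` the right side dominates every finite `r`, by the finite case at `r ^ q⁻¹`.
  rcases eq_or_ne a ∞ with rfl | ha
  · rw [ENNReal.top_rpow_of_pos hq, eq_comm]
    refine ENNReal.eq_top_of_forall_nnreal_le fun r => ?_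
    have h := hfin ((r : ℝ) ^ q⁻¹) (by positivity)
    rw [ENNReal.ofReal_rpow_of_nonneg (by positivity) hq.le, ← Real.rpow_mul r.coe_nonneg,
      inv_mul_cancel₀ hq.ne', Real.rpow_one, ENNReal.ofReal_coe_nnreal] at h
    rw [h]
    refine lintegral_mono fun t => ?_
    gcongr
    split_ifs <;> simp_all
  · simpa [ENNReal.ofReal_toReal ha] using hfin a.toReal ENNReal.toReal_nonneg

lemma lintegral_rpow_eq_lintegral_measure_lt {β : Type*} [MeasurableSpace β] {μ : Measure β}
    [SFinite μ] {f : β → ℝ≥0∞} (hf : Measurable f) {q : ℝ} (hq : 0 < q) :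
    ∫⁻ x, f x ^ q ∂μ = ∫⁻ t in Ioi (0 : ℝ), ENNReal.ofReal (q * t ^ (q - 1)) *
      μ {x | ENNReal.ofReal t < f x} := by
  simp_rw [rpow_eq_lintegral_indicator hq]
  rw [lintegral_lintegral_swap]
  · refine lintegral_congr fun t => ?_
    have hm : MeasurableSet {x | ENNReal.ofReal t < f x} := measurableSet_lt measurable_const hf
    rw [lintegral_const_mul]
    · congr 1
      rw [← lintegral_indicator_one hm]
      refine lintegral_congr fun x => ?_
      simp [indicator]
    · exact Measurable.ite hm measurable_const measurable_const
  · refine Measurable.aemeasurable ?_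
    refine Measurable.mul ?_ ?_
    · fun_prop
    · refine Measurable.ite ?_ measurable_const measurable_const
      exact measurableSet_lt (by fun_prop) (hf.comp measurable_fst)

/-- The part of `f` not exceeding `s` has averages at most `s`, so the remaining `s` must come from
the part above `s`. This is the truncation behind the Marcinkiewicz interpolation. -/
lemma maximal_lt_imp {μ : Measure α} [OpensMeasurableSpace α] {f : α → ℝ≥0∞} (hf : Measurable f)
    {s : ℝ≥0∞} {x : α} (h : 2 * s < maximal μ f x) :
    s < maximal μ ({y | s < f y}.indicator f) x := by
  by_contra! hcon
  refine absurd h (not_lt.2 (iSup_le fun q => ?_))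
  have hB : MeasurableSet {y | s < f y} := measurableSet_lt measurable_const hf
  have h1 : ∫⁻ y in Metric.closedBall x ((q : ℚ) : ℝ), f y ∂μ ≤
      (∫⁻ y in Metric.closedBall x ((q : ℚ) : ℝ), {y | s < f y}.indicator f y ∂μ) +
        s * μ (Metric.closedBall x ((q : ℚ) : ℝ)) := by
    rw [← setLIntegral_const, ← lintegral_add_right _ measurable_const]
    refine lintegral_mono fun y => ?_
    by_cases hy : s < f y
    · simp [indicator, hy]
    · simp [indicator, hy, not_lt.1 hy]
  calc _ ≤ _ := ENNReal.div_le_div_right h1 _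
    _ ≤ s + s := by
      rw [ENNReal.add_div, mul_div_assoc]
      refine add_le_add ((le_iSup (fun q : {q : ℚ // 0 < q} =>
        (∫⁻ y in Metric.closedBall x (q : ℚ), {y | s < f y}.indicator f y ∂μ) /
          μ (Metric.closedBall x (q : ℚ))) q).trans hcon) ?_
      exact mul_le_of_le_one_right' ENNReal.div_self_le_one
    _ = 2 * s := (two_mul s).symm

/-- The strong type (p,p) bound for the centered maximal function, with a constant that depends only
on the space and on `p`. -/
theorem exists_strongType (α : Type*) [MetricSpace α] [MeasurableSpace α] [BorelSpace α]
    [SecondCountableTopology α] [HasBesicovitchCovering α] {p : ℝ} (hp : 1 < p) :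
    ∃ C : ℝ≥0, ∀ (μ : Measure α) [SFinite μ] (f : α → ℝ≥0∞), Measurable f →
      ∫⁻ x, maximal μ f x ^ p ∂μ ≤ C * ∫⁻ x, f x ^ p ∂μ := by
  obtain ⟨N, hN⟩ := exists_weakType α
  -- `N * 2` is the weak type bound at height `t / 2`, `p / (p - 1)` turns `p t^{p-2}` into the
  -- layer cake density of exponent `p - 1`, and `2 ^ (p - 1)` comes from `(2 f)^{p-1}`.
  refine ⟨N * 2 * Real.toNNReal (p / (p - 1)) * 2 ^ (p - 1), fun μ _ f hf => ?_⟩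
  have hp1 : 0 < p - 1 := by linarith
  have h2 : ∀ t ∈ Ioi (0 : ℝ), μ {x | ENNReal.ofReal t < maximal μ f x} ≤
      N * 2 * ENNReal.ofReal (t⁻¹) *
        ∫⁻ x, f x * (if ENNReal.ofReal t < 2 * f x then 1 else 0) ∂μ := by
    intro t ht
    have ht' : (0 : ℝ) < t := ht
    set s := ENNReal.ofReal (t / 2) with hs
    have h2s : ENNReal.ofReal t = 2 * s := by
      rw [hs, ← ENNReal.ofReal_ofNat 2, ← ENNReal.ofReal_mul (by norm_num)]
      congr 1; ring
    have hs0 : s ≠ 0 := by simp [hs, ht']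
    have hst : s ≠ ∞ := ENNReal.ofReal_ne_top
    have h3 := hN μ ({y | s < f y}.indicator f) s
    have h4 : N * 2 * ENNReal.ofReal (t⁻¹) = N * s⁻¹ := by
      rw [hs, ← ENNReal.ofReal_inv_of_pos (by positivity), mul_assoc]
      congr 1
      rw [← ENNReal.ofReal_ofNat 2, ← ENNReal.ofReal_mul (by norm_num)]
      congr 1; field_simp
    have h5 : ∀ x, f x * (if ENNReal.ofReal t < 2 * f x then 1 else 0) =
        {y | s < f y}.indicator f x := by
      intro x
      have : ENNReal.ofReal t < 2 * f x ↔ s < f x := by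
        rw [h2s, ENNReal.mul_lt_mul_iff_right (by norm_num) (by norm_num)]
      simp only [this, indicator, mem_ofPred_eq]
      split_ifs <;> simp
    simp_rw [h5]
    rw [h4, h2s]
    calc μ {x | 2 * s < maximal μ f x}
        ≤ μ {x | s < maximal μ ({y | s < f y}.indicator f) x} :=
          measure_mono fun x hx => maximal_lt_imp hf hx
      _ = s⁻¹ * (s * μ {x | s < maximal μ ({y | s < f y}.indicator f) x}) := by
          rw [← mul_assoc, ENNReal.inv_mul_cancel hs0 hst, one_mul]
      _ ≤ s⁻¹ * (N * ∫⁻ x, {y | s < f y}.indicator f x ∂μ) := by gcongr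
      _ = _ := by ring
  have hmeas : Measurable fun z : ℝ × α => f z.2 *
      (if ENNReal.ofReal z.1 < 2 * f z.2 then (1 : ℝ≥0∞) else 0) := by
    refine (hf.comp measurable_snd).mul (Measurable.ite ?_ measurable_const measurable_const)
    exact measurableSet_lt (by fun_prop) ((hf.comp measurable_snd).const_mul 2)
  set c : ℝ≥0∞ := ENNReal.ofReal (p / (p - 1)) with hc
  calc ∫⁻ x, maximal μ f x ^ p ∂μ
      = ∫⁻ t in Ioi (0 : ℝ), ENNReal.ofReal (p * t ^ (p - 1)) *
          μ {x | ENNReal.ofReal t < maximal μ f x} :=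
        lintegral_rpow_eq_lintegral_measure_lt (measurable_maximal μ hf) (by linarith)
    _ ≤ ∫⁻ t in Ioi (0 : ℝ), ∫⁻ x, (N * 2 * c) * (f x *
          (ENNReal.ofReal ((p - 1) * t ^ (p - 1 - 1)) *
            (if ENNReal.ofReal t < 2 * f x then 1 else 0))) ∂μ := by
        refine setLIntegral_mono' measurableSet_Ioi fun t ht => ?_
        have ht' : (0 : ℝ) < t := ht
        refine (mul_le_mul_right (h2 t ht) _).trans (le_of_eq ?_)
        have hm : Measurable fun x => f x *
            (if ENNReal.ofReal t < 2 * f x then (1 : ℝ≥0∞) else 0) :=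
          hmeas.comp measurable_prodMk_left
        rw [← mul_assoc, ← lintegral_const_mul _ hm]
        refine lintegral_congr fun x => ?_
        have h6 : ENNReal.ofReal (p * t ^ (p - 1)) * ENNReal.ofReal t⁻¹ =
            c * ENNReal.ofReal ((p - 1) * t ^ (p - 1 - 1)) := by
          rw [hc, ← ENNReal.ofReal_mul (by positivity), ← ENNReal.ofReal_mul (by positivity)]
          congr 1
          rw [Real.rpow_sub_one ht'.ne' (p - 1)]
          field_simp
        calc _ = (N * 2) * (ENNReal.ofReal (p * t ^ (p - 1)) * ENNReal.ofReal t⁻¹) *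
            (f x * (if ENNReal.ofReal t < 2 * f x then 1 else 0)) := by ring
          _ = _ := by rw [h6]; ring
    _ = ∫⁻ x, (∫⁻ t in Ioi (0 : ℝ), (N * 2 * c) * (f x *
          (ENNReal.ofReal ((p - 1) * t ^ (p - 1 - 1)) *
            (if ENNReal.ofReal t < 2 * f x then 1 else 0)))) ∂μ := by
        rw [lintegral_lintegral_swap]
        refine Measurable.aemeasurable ?_
        have h7 : Measurable fun z : ℝ × α => ENNReal.ofReal ((p - 1) * z.1 ^ (p - 1 - 1)) := by
          fun_prop
        convert (h7.mul hmeas).const_mul (N * 2 * c) using 1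
        ext z
        simp only [Function.uncurry, Pi.mul_apply]
        ring
    _ = ∫⁻ x, (N * 2 * c) * 2 ^ (p - 1) * f x ^ p ∂μ := by
        refine lintegral_congr fun x => ?_
        have hmx : Measurable fun t : ℝ => ENNReal.ofReal ((p - 1) * t ^ (p - 1 - 1)) *
            (if ENNReal.ofReal t < 2 * f x then (1 : ℝ≥0∞) else 0) := by
          refine Measurable.mul (by fun_prop) (Measurable.ite ?_ measurable_const measurable_const)
          exact measurableSet_lt (by fun_prop) measurable_const
        rw [lintegral_const_mul _ (hmx.const_mul _), lintegral_const_mul _ hmx,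
          ← rpow_eq_lintegral_indicator hp1, ENNReal.mul_rpow_of_nonneg _ _ hp1.le]
        have h8 : f x ^ p = f x * f x ^ (p - 1) := by
          conv_rhs => rw [← ENNReal.rpow_one (f x), ← ENNReal.rpow_mul, one_mul,
            ← ENNReal.rpow_add_of_nonneg _ _ zero_le_one hp1.le]
          congr 1; ring
        rw [h8]; ring
    _ = _ := by
        rw [lintegral_const_mul _ (hf.pow_const p)]
        congr 1
        rw [hc]
        simp only [ENNReal.ofReal]
        push_cast [ENNReal.coe_rpow_of_nonneg _ hp1.le]
        rfl

/-! ### Gaussian averages and the maximal function. -/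

/-- `e^{-d²/(4t)}` is a superposition of indicators of balls. -/
lemma ofReal_exp_neg_sq_div {t : ℝ} (ht : 0 < t) {d : ℝ} (hd : 0 ≤ d) :
    ENNReal.ofReal (Real.exp (-d ^ 2 / (4 * t))) =
      ∫⁻ a in Ioi (0 : ℝ), ENNReal.ofReal (Real.exp (-a)) *
        (if d ≤ √(4 * t * a) then 1 else 0) := by
  have h1 : ∀ a ∈ Ioi (0 : ℝ), ENNReal.ofReal (Real.exp (-a)) *
      (if d ≤ √(4 * t * a) then 1 else 0) =
      (Ici (d ^ 2 / (4 * t))).indicator (fun a => ENNReal.ofReal (Real.exp (-a))) a := by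
    intro a ha
    have ha' : (0 : ℝ) < a := ha
    have : d ≤ √(4 * t * a) ↔ d ^ 2 / (4 * t) ≤ a := by
      rw [Real.le_sqrt hd (by positivity), div_le_iff₀ (by positivity), mul_comm a]
    simp only [this, indicator, mem_Ici]
    split_ifs <;> simp
  have h0 : (0 : ℝ) ≤ d ^ 2 / (4 * t) := by positivity
  have hset : (Ici (d ^ 2 / (4 * t)) ∩ Ioi 0 : Set ℝ) =ᵐ[volume] Ioi (d ^ 2 / (4 * t)) := by
    have : (Ioi (d ^ 2 / (4 * t)) : Set ℝ) = Ioi (d ^ 2 / (4 * t)) ∩ Ioi 0 := by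
      rw [Ioi_inter_Ioi, max_eq_left h0]
    rw [this]
    exact Ioi_ae_eq_Ici.symm.inter (ae_eq_refl _)
  rw [setLIntegral_congr_fun measurableSet_Ioi h1, setLIntegral_indicator measurableSet_Ici,
    Measure.restrict_congr_set hset, ← ofReal_integral_eq_lintegral_ofReal, integral_exp_neg_Ioi]
  · congr 2; ring
  · exact integrableOn_exp_neg_Ioi (d ^ 2 / (4 * t))
  · exact Eventually.of_forall fun a => (Real.exp_pos _).le

section Gaussian

variable [BorelSpace α] [SecondCountableTopology α]

lemma lintegral_mul_exp_eq {μ : Measure α} [SFinite μ] {f : α → ℝ≥0∞} (hf : Measurable f) (x : α)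
    {t : ℝ} (ht : 0 < t) :
    ∫⁻ y, f y * ENNReal.ofReal (Real.exp (-dist y x ^ 2 / (4 * t))) ∂μ =
      ∫⁻ a in Ioi (0 : ℝ), ENNReal.ofReal (Real.exp (-a)) *
        ∫⁻ y in Metric.closedBall x (√(4 * t * a)), f y ∂μ := by
  have hm : Measurable fun z : α × ℝ => ENNReal.ofReal (Real.exp (-z.2)) *
        (if dist z.1 x ≤ √(4 * t * z.2) then (1 : ℝ≥0∞) else 0) := by
    refine Measurable.mul (by fun_prop) (Measurable.ite ?_ measurable_const measurable_const)
    exact measurableSet_le (by fun_prop) (by fun_prop)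
  simp_rw [ofReal_exp_neg_sq_div ht dist_nonneg]
  have h1 : ∀ y, f y * ∫⁻ a in Ioi (0 : ℝ), ENNReal.ofReal (Real.exp (-a)) *
        (if dist y x ≤ √(4 * t * a) then 1 else 0) =
      ∫⁻ a in Ioi (0 : ℝ), f y * (ENNReal.ofReal (Real.exp (-a)) *
        (if dist y x ≤ √(4 * t * a) then 1 else 0)) := fun y =>
    (lintegral_const_mul _ (hm.comp measurable_prodMk_left)).symm
  simp_rw [h1]
  rw [lintegral_lintegral_swap ((hf.comp measurable_fst).mul hm).aemeasurable]
  refine lintegral_congr fun a => ?_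
  have hB : MeasurableSet (Metric.closedBall x (√(4 * t * a))) :=
    Metric.isClosed_closedBall.measurableSet
  rw [← lintegral_indicator hB, ← lintegral_const_mul _ (hf.indicator hB)]
  refine lintegral_congr fun y => ?_
  simp only [indicator, Metric.mem_closedBall]
  split_ifs <;> simp [mul_comm]

/-- A bound for the averages over balls gives a bound for the Gaussian averages. -/
theorem lintegral_mul_exp_le_of_forall {μ : Measure α} [SFinite μ] {f : α → ℝ≥0∞}
    (hf : Measurable f) (x : α) {t : ℝ} (ht : 0 < t) {M : ℝ≥0∞}
    (hM : ∀ r, 0 < r → ∫⁻ y in Metric.closedBall x r, f y ∂μ ≤ M * μ (Metric.closedBall x r)) :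
    ∫⁻ y, f y * ENNReal.ofReal (Real.exp (-dist y x ^ 2 / (4 * t))) ∂μ ≤
      M * ∫⁻ y, ENNReal.ofReal (Real.exp (-dist y x ^ 2 / (4 * t))) ∂μ := by
  have h1 := lintegral_mul_exp_eq (μ := μ) (measurable_const (a := (1 : ℝ≥0∞))) x ht
  simp only [one_mul, lintegral_one, Measure.restrict_apply_univ] at h1
  have hm : Measurable fun a : ℝ => ENNReal.ofReal (Real.exp (-a)) *
      μ (Metric.closedBall x (√(4 * t * a))) := by
    refine Measurable.mul (by fun_prop) ?_
    -- Measurability in the radius comes for free from monotonicity.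
    have : Monotone fun r : ℝ => μ (Metric.closedBall x r) := fun r s hrs =>
      measure_mono (Metric.closedBall_subset_closedBall hrs)
    exact this.measurable.comp (by fun_prop)
  rw [lintegral_mul_exp_eq hf x ht, h1, ← lintegral_const_mul _ hm]
  refine setLIntegral_mono' measurableSet_Ioi fun a ha => ?_
  have ha' : (0 : ℝ) < a := ha
  calc _ ≤ ENNReal.ofReal (Real.exp (-a)) * (M * μ (Metric.closedBall x (√(4 * t * a)))) := by
        gcongr; exact hM _ (Real.sqrt_pos.2 (by positivity))
    _ = _ := by ring

/-- Gaussian averages are dominated by the centered maximal function, for any measure. -/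
theorem lintegral_mul_exp_le {μ : Measure α} [SFinite μ]
    (hμ : ∀ x r, μ (Metric.closedBall x r) < ∞) {f : α → ℝ≥0∞} (hf : Measurable f) (x : α)
    {t : ℝ} (ht : 0 < t) :
    ∫⁻ y, f y * ENNReal.ofReal (Real.exp (-dist y x ^ 2 / (4 * t))) ∂μ ≤
      maximal μ f x * ∫⁻ y, ENNReal.ofReal (Real.exp (-dist y x ^ 2 / (4 * t))) ∂μ :=
  lintegral_mul_exp_le_of_forall hf x ht fun _ hr => lintegral_closedBall_le hμ f x hr.le

end Gaussian

end CenteredMaximal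

/-! ### Sums and integrals of products over finitely many coordinates. -/

lemma ENNReal.tsum_pi_prod {β : Type*} {n : ℕ} (a : Fin n → β → ℝ≥0∞) :
    ∑' k : Fin n → β, ∏ i, a i (k i) = ∏ i, ∑' j, a i j := by
  induction n with
  | zero => simp
  | succ n ih =>
    rw [← (Fin.consEquiv fun _ => β).tsum_eq, ENNReal.tsum_prod', Fin.prod_univ_succ]
    simp only [Fin.consEquiv, Equiv.coe_fn_mk, Fin.prod_univ_succ, Fin.cons_zero, Fin.cons_succ,
      ENNReal.tsum_mul_left, ENNReal.tsum_mul_right]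
    rw [ih fun i => a i.succ]

lemma MeasureTheory.lintegral_volume_pi_prod {β : Type*} [MeasureSpace β]
    [SigmaFinite (volume : Measure β)] {n : ℕ} {f : Fin n → β → ℝ≥0∞} (hf : ∀ i, Measurable (f i)) :
    ∫⁻ x : Fin n → β, ∏ i, f i (x i) = ∏ i, ∫⁻ x, f i x := by
  induction n with
  | zero => simp [volume_pi]
  | succ n ih =>
    rw [← (volume_preserving_piFinSuccAbove (fun _ : Fin (n + 1) => β) 0).symm.lintegral_comp_emb
      (MeasurableEquiv.measurableEmbedding _), Fin.prod_univ_succ]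
    simp only [Fin.prod_univ_succ, MeasurableEquiv.piFinSuccAbove_symm_apply,
      Fin.insertNthEquiv_apply, Fin.insertNth_zero', Fin.cons_zero, Fin.cons_succ]
    rw [Measure.volume_eq_prod]
    rw [lintegral_prod_mul (f := f 0) (g := fun x : Fin n → β => ∏ i : Fin n, f i.succ (x i))
      (hf 0).aemeasurable
      (Finset.measurable_prod _ fun i _ => (hf _).comp (measurable_pi_apply i)).aemeasurable,
      ih fun i => hf i.succ]

/-! ### The periodized Gaussian and the heat kernel of the waveguide. -/

namespace Waveguide

variable {n m : ℕ}

lemma rep_mem (x : UnitAddCircle) : -1 / 2 ≤ rep x ∧ rep x < 1 / 2 := by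
  have h := (AddCircle.equivIco (1 : ℝ) (-1 / 2) x).2
  have h2 : (-1 / 2 : ℝ) + 1 = 1 / 2 := by norm_num
  exact ⟨h.1, h.2.trans_eq h2⟩

lemma abs_rep_le (x : UnitAddCircle) : |rep x| ≤ 1 / 2 :=
  abs_le.2 ⟨by linarith [(rep_mem x).1], (rep_mem x).2.le⟩

lemma measurable_rep : Measurable rep :=
  measurable_subtype_coe.comp (AddCircle.measurableEquivIco (1 : ℝ) (-1 / 2)).measurable

lemma exists_int_add_of_coe_eq {x y : ℝ} (h : (x : UnitAddCircle) = y) : ∃ j : ℤ, x = y + j := by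
  rw [← sub_eq_zero, ← AddCircle.coe_sub, AddCircle.coe_eq_zero_iff] at h
  obtain ⟨j, hj⟩ := h
  refine ⟨j, ?_⟩
  simp only [zsmul_eq_mul, mul_one] at hj
  linarith

lemma exists_rep_sub (x y : UnitAddCircle) : ∃ j : ℤ, rep (x - y) = rep x - rep y + j :=
  exists_int_add_of_coe_eq (by rw [AddCircle.coe_sub]; simp only [coe_rep])

/-- The one-dimensional periodized Gaussian. -/
def theta (t x : ℝ) : ℝ≥0∞ :=
  ∑' j : ℤ, ENNReal.ofReal (Real.exp (-(x + j) ^ 2 / (4 * t)))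

lemma measurable_theta (t : ℝ) : Measurable (theta t) :=
  Measurable.tsum fun j => by fun_prop

lemma theta_add_int (t x : ℝ) (j : ℤ) : theta t (x + j) = theta t x := by
  unfold theta
  rw [← (Equiv.addLeft j).tsum_eq
    fun i : ℤ => ENNReal.ofReal (Real.exp (-(x + i) ^ 2 / (4 * t)))]
  refine tsum_congr fun i => ?_
  simp [add_assoc]

lemma theta_rep_coe (t x : ℝ) : theta t (rep (x : UnitAddCircle)) = theta t x := by
  obtain ⟨j, hj⟩ := exists_int_add_of_coe_eq (coe_rep (x : UnitAddCircle))
  rw [hj, theta_add_int]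

/-- The constant comparing the periodized Gaussian with the Gaussian for times up to `R`. -/
def thetaConst (R : ℝ) : ℝ≥0∞ :=
  ∑' j : ℤ, ENNReal.ofReal (Real.exp (-((j : ℝ) ^ 2 - |(j : ℝ)|) / (4 * R)))

/-- Since `(|j| - 1)² ≥ 0`, one has `j² - |j| ≥ |j| - 1`, so a geometric series dominates. -/
lemma thetaConst_lt_top {R : ℝ} (hR : 0 < R) : thetaConst R < ∞ := by
  have hr1 : Real.exp (-(1 / (4 * R))) < 1 := Real.exp_lt_one_iff.2 (by simp; positivity)
  have hs : Summable fun j : ℤ => Real.exp (1 / (4 * R)) * Real.exp (-(1 / (4 * R))) ^ j.natAbs := by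
    refine Summable.mul_left _ ?_
    have := summable_geometric_of_lt_one (Real.exp_pos (-(1 / (4 * R)))).le hr1
    refine Summable.of_nat_of_neg (by simpa using this) (by simpa using this)
  refine lt_of_le_of_lt (ENNReal.tsum_le_tsum fun j => ENNReal.ofReal_le_ofReal ?_)
    hs.tsum_ofReal_lt_top
  rw [← Real.exp_nat_mul, ← Real.exp_add]
  refine Real.exp_le_exp.2 ?_
  have h1 : ((j.natAbs : ℕ) : ℝ) = |(j : ℝ)| := by simp [Nat.cast_natAbs]
  rw [h1]
  have h2 : -((j : ℝ) ^ 2 - |(j : ℝ)|) ≤ 1 - |(j : ℝ)| := by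
    nlinarith [sq_nonneg (|(j : ℝ)| - 1), sq_abs (j : ℝ)]
  calc _ ≤ (1 - |(j : ℝ)|) / (4 * R) := by gcongr
    _ = _ := by ring

/-- For `|x| ≤ 1/2` one has `(x + j)² ≥ x² + (j² - |j|)`. The last bracket is nonnegative for
integers, so in its term `t` may be replaced by the larger `R`; this makes the constant independent
of `t`. -/
lemma theta_le {t R x : ℝ} (ht : 0 < t) (htR : t ≤ R) (hx : |x| ≤ 1 / 2) :
    theta t x ≤ thetaConst R * ENNReal.ofReal (Real.exp (-x ^ 2 / (4 * t))) := by
  unfold theta thetaConst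
  rw [← ENNReal.tsum_mul_right]
  refine ENNReal.tsum_le_tsum fun j => ?_
  rw [← ENNReal.ofReal_mul (Real.exp_pos _).le, ← Real.exp_add]
  refine ENNReal.ofReal_le_ofReal (Real.exp_le_exp.2 ?_)
  have h0 : 0 ≤ (j : ℝ) ^ 2 - |(j : ℝ)| := by
    have : |j| ≤ j ^ 2 := by
      rw [← sq_abs]
      exact Int.le_self_sq _
    have : ((|j| : ℤ) : ℝ) ≤ ((j ^ 2 : ℤ) : ℝ) := by exact_mod_cast this
    push_cast at this
    linarith
  have h1 : (j : ℝ) ^ 2 - |(j : ℝ)| + x ^ 2 ≤ (x + j) ^ 2 := by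
    have : |x * j| ≤ 1 / 2 * |(j : ℝ)| := by
      rw [abs_mul]; gcongr
    nlinarith [neg_abs_le (x * j)]
  have h2 : ((j : ℝ) ^ 2 - |(j : ℝ)|) / (4 * R) ≤ ((j : ℝ) ^ 2 - |(j : ℝ)|) / (4 * t) := by gcongr
  have h3 : ((j : ℝ) ^ 2 - |(j : ℝ)| + x ^ 2) / (4 * t) ≤ (x + j) ^ 2 / (4 * t) := by gcongr
  rw [add_div] at h3
  rw [neg_div, neg_div, neg_div]
  linarith

/-- Unfolding: the integer translates of the unit interval tile the line, so integrating the
periodization over the circle gives the full Gaussian integral. -/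
lemma lintegral_theta_rep {t : ℝ} (ht : 0 < t) :
    ∫⁻ x : UnitAddCircle, theta t (rep x) = ENNReal.ofReal (√(4 * Real.pi * t)) := by
  rw [← UnitAddCircle.lintegral_preimage (-1 / 2)]
  simp_rw [theta_rep_coe]
  rw [Measure.restrict_congr_set Ico_ae_eq_Ioc.symm]
  unfold theta
  rw [lintegral_tsum fun j => by fun_prop]
  set g : ℝ → ℝ≥0∞ := fun x => ENNReal.ofReal (Real.exp (-x ^ 2 / (4 * t))) with hg
  have h1 : ∀ j : ℤ, ∫⁻ x in Ico (-1 / 2 : ℝ) (-1 / 2 + 1), g (x + j) =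
      ∫⁻ x in Ico (-1 / 2 + (j : ℝ)) (-1 / 2 + j + 1), g x := by
    intro j
    rw [← (measurePreserving_add_right volume (j : ℝ)).setLIntegral_comp_preimage
      (s := Ico (-1 / 2 + (j : ℝ)) (-1 / 2 + j + 1)) measurableSet_Ico (by fun_prop)]
    congr 2
    ext x
    simp only [mem_Ico, mem_preimage]
    constructor <;> rintro ⟨h, h'⟩ <;> constructor <;> linarith
  have h2 : ∀ j : ℤ, ∫⁻ x in Ico (-1 / 2 : ℝ) (-1 / 2 + 1),
      ENNReal.ofReal (Real.exp (-(x + j) ^ 2 / (4 * t))) =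
      ∫⁻ x in Ico (-1 / 2 + (j : ℝ)) (-1 / 2 + j + 1), g x := h1
  simp_rw [h2]
  rw [← lintegral_iUnion (fun _ => measurableSet_Ico) (pairwise_disjoint_Ico_add_intCast _),
    iUnion_Ico_add_intCast, Measure.restrict_univ, hg, ← ofReal_integral_eq_lintegral_ofReal]
  · congr 1
    have := integral_gaussian (1 / (4 * t))
    calc _ = ∫ x : ℝ, Real.exp (-(1 / (4 * t)) * x ^ 2) := by
          congr 1; ext x; congr 1; ring
      _ = _ := by rw [this]; congr 1; field_simp
  · have := integrable_exp_neg_mul_sq (b := 1 / (4 * t)) (by positivity)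
    refine this.congr (Eventually.of_forall fun x => ?_)
    simp only
    congr 1; ring
  · exact Eventually.of_forall fun x => (Real.exp_pos _).le

/-- The normalizing factor of the heat kernel. -/
def normFactor (n m : ℕ) (t : ℝ) : ℝ := (4 * Real.pi * t) ^ (-(((n : ℝ) + m) / 2))

lemma normFactor_pos {t : ℝ} (ht : 0 < t) : 0 < normFactor n m t := by
  unfold normFactor; positivity

/-- The squared flat distance to the origin. -/
def sqNorm (z : Waveguide n m) : ℝ := (∑ i, rep (z.1 i) ^ 2) + ‖z.2‖ ^ 2

/-- The heat kernel with values in `[0, ∞]`. -/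
def eKernel (t : ℝ) (z : Waveguide n m) : ℝ≥0∞ :=
  ENNReal.ofReal (normFactor n m t) *
    ∑' k : Fin n → ℤ,
      ENNReal.ofReal (Real.exp (-((∑ i, (rep (z.1 i) + k i) ^ 2) + ‖z.2‖ ^ 2) / (4 * t)))

lemma ofReal_exp_sum (t b : ℝ) (a : Fin n → ℝ) :
    ENNReal.ofReal (Real.exp (-((∑ i, a i ^ 2) + b) / (4 * t))) =
      ENNReal.ofReal (Real.exp (-b / (4 * t))) *
        ∏ i, ENNReal.ofReal (Real.exp (-a i ^ 2 / (4 * t))) := by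
  rw [← ENNReal.ofReal_prod_of_nonneg fun i _ => (Real.exp_pos _).le,
    ← ENNReal.ofReal_mul (Real.exp_pos _).le, ← Real.exp_sum, ← Real.exp_add]
  congr 2
  rw [← Finset.sum_div, Finset.sum_neg_distrib]
  ring

lemma eKernel_eq_prod (t : ℝ) (z : Waveguide n m) :
    eKernel t z = ENNReal.ofReal (normFactor n m t) *
      (ENNReal.ofReal (Real.exp (-‖z.2‖ ^ 2 / (4 * t))) * ∏ i, theta t (rep (z.1 i))) := by
  unfold eKernel theta
  simp_rw [ofReal_exp_sum]
  rw [ENNReal.tsum_mul_left, ← ENNReal.tsum_pi_prod]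

lemma eKernel_le {t R : ℝ} (ht : 0 < t) (htR : t ≤ R) (z : Waveguide n m) :
    eKernel t z ≤ thetaConst R ^ n * (ENNReal.ofReal (normFactor n m t) *
      ENNReal.ofReal (Real.exp (-sqNorm z / (4 * t)))) := by
  rw [eKernel_eq_prod, sqNorm, ofReal_exp_sum]
  calc _ ≤ ENNReal.ofReal (normFactor n m t) * (ENNReal.ofReal (Real.exp (-‖z.2‖ ^ 2 / (4 * t))) *
        ∏ i, (thetaConst R * ENNReal.ofReal (Real.exp (-rep (z.1 i) ^ 2 / (4 * t))))) := by
        gcongr with i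
        exact theta_le ht htR (abs_rep_le _)
    _ = _ := by
        rw [Finset.prod_mul_distrib]
        simp only [Finset.prod_const, Finset.card_univ, Fintype.card_fin]
        ring

/-- Only the term `k = 0` of the lattice sum is kept. -/
lemma le_eKernel (t : ℝ) (z : Waveguide n m) :
    ENNReal.ofReal (normFactor n m t) * ENNReal.ofReal (Real.exp (-sqNorm z / (4 * t))) ≤
      eKernel t z := by
  unfold eKernel
  gcongr
  refine le_trans (le_of_eq ?_) (ENNReal.le_tsum (0 : Fin n → ℤ))
  simp [sqNorm]

lemma eKernel_lt_top {t : ℝ} (ht : 0 < t) (z : Waveguide n m) : eKernel t z < ∞ :=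
  (eKernel_le ht le_rfl z).trans_lt (ENNReal.mul_lt_top
    (ENNReal.pow_lt_top (thetaConst_lt_top ht))
    (ENNReal.mul_lt_top ENNReal.ofReal_lt_top ENNReal.ofReal_lt_top))

lemma eKernel_toReal {t : ℝ} (ht : 0 < t) (z : Waveguide n m) :
    (eKernel t z).toReal = heatKernel t z := by
  unfold eKernel heatKernel
  rw [ENNReal.toReal_mul, ENNReal.toReal_ofReal (normFactor_pos ht).le,
    ENNReal.tsum_toReal_eq fun _ => ENNReal.ofReal_ne_top]
  congr 1
  exact tsum_congr fun k => ENNReal.toReal_ofReal (Real.exp_pos _).le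

lemma ofReal_heatKernel {t : ℝ} (ht : 0 < t) (z : Waveguide n m) :
    ENNReal.ofReal (heatKernel t z) = eKernel t z := by
  rw [← eKernel_toReal ht, ENNReal.ofReal_toReal (eKernel_lt_top ht z).ne]

lemma measurable_eKernel (t : ℝ) : Measurable (eKernel t : Waveguide n m → ℝ≥0∞) := by
  have : (eKernel t : Waveguide n m → ℝ≥0∞) = fun z => ENNReal.ofReal (normFactor n m t) *
      (ENNReal.ofReal (Real.exp (-‖z.2‖ ^ 2 / (4 * t))) * ∏ i, theta t (rep (z.1 i))) :=
    funext fun z => eKernel_eq_prod t z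
  rw [this]
  refine Measurable.const_mul (Measurable.mul (by fun_prop) ?_) _
  exact Finset.measurable_prod _ fun i _ => (measurable_theta t).comp
    (measurable_rep.comp ((measurable_pi_apply i).comp measurable_fst))

lemma lintegral_exp_neg_norm_sq {t : ℝ} (ht : 0 < t) :
    ∫⁻ y : EuclideanSpace ℝ (Fin m), ENNReal.ofReal (Real.exp (-‖y‖ ^ 2 / (4 * t))) =
      ENNReal.ofReal ((4 * Real.pi * t) ^ ((m : ℝ) / 2)) := by
  have h := GaussianFourier.integral_rexp_neg_mul_sq_norm (V := EuclideanSpace ℝ (Fin m))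
    (b := 1 / (4 * t)) (by positivity)
  have h1 : ∀ y : EuclideanSpace ℝ (Fin m), Real.exp (-(1 / (4 * t)) * ‖y‖ ^ 2) =
      Real.exp (-‖y‖ ^ 2 / (4 * t)) := fun y => by congr 1; ring
  simp_rw [h1] at h
  have hpos : (0 : ℝ) < (Real.pi / (1 / (4 * t))) ^
      ((Module.finrank ℝ (EuclideanSpace ℝ (Fin m)) : ℝ) / 2) := by positivity
  rw [← ofReal_integral_eq_lintegral_ofReal, h]
  · rw [finrank_euclideanSpace, Fintype.card_fin]
    congr 2
    field_simp
  -- Integrability follows from the value of the integral: it is positive, while a nonintegrable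
  -- function has Bochner integral `0`.
  · by_contra hcon
    rw [integral_undef hcon] at h
    exact hpos.ne h
  · exact Eventually.of_forall fun x => (Real.exp_pos _).le

theorem lintegral_eKernel {t : ℝ} (ht : 0 < t) : ∫⁻ z : Waveguide n m, eKernel t z = 1 := by
  have hpi : 0 < 4 * Real.pi * t := by positivity
  have h1 : Measurable fun x : UnitAddTorus (Fin n) => ∏ i, theta t (rep (x i)) :=
    Finset.measurable_prod _ fun i _ => (measurable_theta t).comp
      (measurable_rep.comp (measurable_pi_apply i))
  simp_rw [eKernel_eq_prod, mul_comm (ENNReal.ofReal (Real.exp _))]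
  rw [lintegral_const_mul, Measure.volume_eq_prod,
    lintegral_prod_mul (f := fun x : UnitAddTorus (Fin n) => ∏ i, theta t (rep (x i)))
      (g := fun y : EuclideanSpace ℝ (Fin m) => ENNReal.ofReal (Real.exp (-‖y‖ ^ 2 / (4 * t))))
      h1.aemeasurable (by fun_prop), lintegral_exp_neg_norm_sq ht]
  · have h2 : ∫⁻ x : UnitAddTorus (Fin n), ∏ i, theta t (rep (x i)) =
        ∏ _i : Fin n, ENNReal.ofReal (√(4 * Real.pi * t)) := by
      rw [← lintegral_theta_rep ht]
      exact lintegral_volume_pi_prod (f := fun (_ : Fin n) (x : UnitAddCircle) => theta t (rep x))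
        fun _ => (measurable_theta t).comp measurable_rep
    rw [h2, ← ENNReal.ofReal_prod_of_nonneg fun i _ => Real.sqrt_nonneg _,
      ← ENNReal.ofReal_mul (by positivity), ← ENNReal.ofReal_mul (normFactor_pos ht).le,
      ← ENNReal.ofReal_one]
    congr 1
    simp only [Finset.prod_const, Finset.card_univ, Fintype.card_fin]
    rw [Real.sqrt_eq_rpow, ← Real.rpow_natCast, ← Real.rpow_mul hpi.le, ← Real.rpow_add hpi,
      normFactor, ← Real.rpow_add hpi]
    ring_nf
    exact Real.rpow_zero _
  · exact (h1.comp measurable_fst).mul (by fun_prop)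

instance : (volume : Measure (Waveguide n m)).IsAddHaarMeasure :=
  Measure.prod.instIsAddHaarMeasure _ _

lemma theta_neg (t x : ℝ) : theta t (-x) = theta t x := by
  unfold theta
  rw [← (Equiv.neg ℤ).tsum_eq]
  refine tsum_congr fun j => ?_
  simp only [Equiv.neg_apply, Int.cast_neg]
  congr 4
  ring

lemma eKernel_neg (t : ℝ) (z : Waveguide n m) : eKernel t (-z) = eKernel t z := by
  have h : ∀ x : UnitAddCircle, theta t (rep (-x)) = theta t (rep x) := by
    intro x
    obtain ⟨j, hj⟩ : ∃ j : ℤ, rep (-x) = -rep x + j :=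
      exists_int_add_of_coe_eq (by rw [AddCircle.coe_neg]; simp only [coe_rep])
    rw [hj, theta_add_int, theta_neg]
  simp only [eKernel_eq_prod, Prod.fst_neg, Prod.snd_neg, norm_neg, Pi.neg_apply, h]

theorem lintegral_eKernel_sub {t : ℝ} (ht : 0 < t) (z : Waveguide n m) :
    ∫⁻ z' : Waveguide n m, eKernel t (z - z') = 1 := by
  rw [← lintegral_eKernel (n := n) (m := m) ht]
  refine Eq.trans (lintegral_congr fun z' => ?_)
    (lintegral_sub_right_eq_self (fun z' : Waveguide n m => eKernel t z') z)
  rw [← eKernel_neg, neg_sub]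

/-! ### Lifting measures and maximal functions to the cover. -/

/-- The Euclidean space covering the waveguide. -/
abbrev Cover (n m : ℕ) : Type := EuclideanSpace ℝ (Fin n ⊕ Fin m)

/-- The lift of a point of the waveguide to the cell of the cover with index `k`. -/
def lift (k : Fin n → ℤ) (z : Waveguide n m) : Cover n m :=
  WithLp.toLp 2 (Sum.elim (fun i => rep (z.1 i) + k i) z.2)

/-- The covering map. -/
def proj (w : Cover n m) : Waveguide n m :=
  (fun i => (w (Sum.inl i) : UnitAddCircle), WithLp.toLp 2 fun j => w (Sum.inr j))

lemma proj_lift (k : Fin n → ℤ) (z : Waveguide n m) : proj (lift k z) = z := by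
  refine Prod.ext ?_ rfl
  ext i
  simp only [proj, lift, Sum.elim_inl]
  rw [AddCircle.coe_add, coe_rep, add_eq_left, AddCircle.coe_eq_zero_iff]
  exact ⟨k i, by simp⟩

lemma measurable_lift (k : Fin n → ℤ) : Measurable (lift k : Waveguide n m → Cover n m) := by
  refine (WithLp.measurable_toLp 2 _).comp (measurable_pi_iff.2 ?_)
  rintro (i | j)
  · exact (measurable_rep.comp ((measurable_pi_apply i).comp measurable_fst)).add_const _
  · simp only [Sum.elim_inr]
    fun_prop

lemma measurable_proj : Measurable (proj : Cover n m → Waveguide n m) := by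
  refine Measurable.prodMk (measurable_pi_iff.2 fun i => ?_) ?_
  · exact AddCircle.measurable_mk'.comp (by fun_prop)
  · fun_prop

lemma dist_lift_sq (k l : Fin n → ℤ) (z z' : Waveguide n m) :
    dist (lift k z') (lift l z) ^ 2 =
      (∑ i, (rep (z.1 i) - rep (z'.1 i) + (l i - k i)) ^ 2) + ‖z.2 - z'.2‖ ^ 2 := by
  rw [EuclideanSpace.dist_eq, Real.sq_sqrt (by positivity), Fintype.sum_sum_type,
    EuclideanSpace.norm_eq, Real.sq_sqrt (by positivity)]
  congr 1
  · refine Finset.sum_congr rfl fun i _ => ?_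
    simp only [lift, Sum.elim_inl, Real.dist_eq, sq_abs]
    ring
  · refine Finset.sum_congr rfl fun j _ => ?_
    simp only [lift, Sum.elim_inr, Real.dist_eq, sq_abs, Real.norm_eq_abs, PiLp.sub_apply]
    ring

/-- The indices of the cells neighbouring the fundamental cell. -/
def shifts (n : ℕ) : Finset (Fin n → ℤ) := Finset.Icc (-1) 1

/-- The lift of a measure to the fundamental cell and its neighbours. -/
def coverMeasure (ν : Measure (Waveguide n m)) : Measure (Cover n m) :=
  Measure.sum fun k : shifts n => ν.map (lift k)

instance (ν : Measure (Waveguide n m)) [SFinite ν] : SFinite (coverMeasure ν) := by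
  unfold coverMeasure; infer_instance

lemma lintegral_coverMeasure (ν : Measure (Waveguide n m)) {F : Cover n m → ℝ≥0∞}
    (hF : Measurable F) :
    ∫⁻ w, F w ∂(coverMeasure ν) = ∑ k ∈ shifts n, ∫⁻ z, F (lift k z) ∂ν := by
  rw [coverMeasure, lintegral_sum_measure, tsum_fintype,
    ← Finset.sum_coe_sort (shifts n) fun k => ∫⁻ z, F (lift k z) ∂ν]
  exact Finset.sum_congr rfl fun k _ => lintegral_map hF (measurable_lift _)

lemma lintegral_comp_proj (ν : Measure (Waveguide n m)) {F : Waveguide n m → ℝ≥0∞}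
    (hF : Measurable F) :
    ∫⁻ w, F (proj w) ∂(coverMeasure ν) = (shifts n).card * ∫⁻ z, F z ∂ν := by
  rw [lintegral_coverMeasure ν (F := fun w => F (proj w)) (hF.comp measurable_proj)]
  simp [proj_lift]

lemma zero_mem_shifts : (0 : Fin n → ℤ) ∈ shifts n :=
  Finset.mem_Icc.2 ⟨fun i => by simp, fun i => by simp⟩

lemma map_lift_le (ν : Measure (Waveguide n m)) : ν.map (lift 0) ≤ coverMeasure ν := by
  have h := Measure.le_sum (fun k : shifts n => ν.map (lift (k : Fin n → ℤ)))
    (⟨0, zero_mem_shifts⟩ : shifts n)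
  unfold coverMeasure
  exact h

lemma lintegral_comp_lift_le (ν : Measure (Waveguide n m)) {F : Cover n m → ℝ≥0∞}
    (hF : Measurable F) : ∫⁻ z, F (lift 0 z) ∂ν ≤ ∫⁻ w, F w ∂(coverMeasure ν) := by
  rw [← lintegral_map hF (measurable_lift 0)]
  exact lintegral_mono' (map_lift_le ν) le_rfl

lemma ae_comp_lift {ν : Measure (Waveguide n m)} {p : Cover n m → Prop}
    (h : ∀ᵐ w ∂(coverMeasure ν), p w) : ∀ᵐ z ∂ν, p (lift 0 z) :=
  ae_of_ae_map (measurable_lift 0).aemeasurable ((map_lift_le ν).absolutelyContinuous.ae_le h)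

/-- A measure which is finite on the sets where the Euclidean coordinate is bounded. -/
def FiniteOnSlabs (ν : Measure (Waveguide n m)) : Prop :=
  ∀ r : ℝ, ν {z | ‖z.2‖ ≤ r} < ∞

lemma norm_snd_le (k : Fin n → ℤ) (z : Waveguide n m) : ‖z.2‖ ≤ ‖lift k z‖ := by
  rw [EuclideanSpace.norm_eq, EuclideanSpace.norm_eq, Fintype.sum_sum_type]
  refine Real.sqrt_le_sqrt ?_
  have : (0 : ℝ) ≤ ∑ i : Fin n, ‖(lift k z) (Sum.inl i)‖ ^ 2 := by positivity
  exact le_add_of_nonneg_left this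

/-- Points whose lift lies in the ball have `‖y‖ ≤ r + ‖w‖`, and only finitely many cells carry
mass. -/
lemma FiniteOnSlabs.coverMeasure_closedBall_lt_top {ν : Measure (Waveguide n m)}
    (hν : FiniteOnSlabs ν) (w : Cover n m) (r : ℝ) :
    coverMeasure ν (Metric.closedBall w r) < ∞ := by
  rw [← lintegral_indicator_one Metric.isClosed_closedBall.measurableSet,
    lintegral_coverMeasure ν (measurable_one.indicator Metric.isClosed_closedBall.measurableSet)]
  refine ENNReal.sum_lt_top.2 fun k _ => lt_of_le_of_lt ?_ (hν (r + ‖w‖))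
  rw [← lintegral_indicator_one (measurableSet_le (by fun_prop) measurable_const)]
  refine lintegral_mono fun z => ?_
  by_cases h : lift k z ∈ Metric.closedBall w r
  · have h1 : ‖z.2‖ ≤ r + ‖w‖ := by
      have h2 : ‖lift k z‖ ≤ ‖lift k z - w‖ + ‖w‖ := by
        simpa using norm_add_le (lift k z - w) w
      rw [Metric.mem_closedBall, dist_eq_norm] at h
      linarith [norm_snd_le k z]
    rw [indicator_of_mem h, indicator_of_mem (show z ∈ {z : Waveguide n m | ‖z.2‖ ≤ r + ‖w‖} from h1)]
    exact le_rfl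
  · simp [h]

/-- The Gaussians centered at the lifts of `z'` to the neighbouring cells. -/
def nearSum (t : ℝ) (z z' : Waveguide n m) : ℝ≥0∞ :=
  ∑ k ∈ shifts n, ENNReal.ofReal (Real.exp (-dist (lift k z') (lift 0 z) ^ 2 / (4 * t)))

lemma exists_rep_sub_fst (z z' : Waveguide n m) :
    ∃ j : Fin n → ℤ, ∀ i, rep ((z - z').1 i) = rep (z.1 i) - rep (z'.1 i) + j i := by
  have h : ∀ i, ∃ j : ℤ, rep ((z - z').1 i) = rep (z.1 i) - rep (z'.1 i) + j := fun i =>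
    exists_rep_sub _ _
  choose j hj using h
  exact ⟨j, hj⟩

/-- The representative of a difference equals the difference of representatives up to an integer
vector, so the Gaussians in `nearSum` are distinct terms of the lattice sum. -/
lemma normFactor_mul_nearSum_le (t : ℝ) (z z' : Waveguide n m) :
    ENNReal.ofReal (normFactor n m t) * nearSum t z z' ≤ eKernel t (z - z') := by
  obtain ⟨j, hj⟩ := exists_rep_sub_fst z z'
  unfold eKernel nearSum
  gcongr
  have h : ∀ k : Fin n → ℤ, ENNReal.ofReal (Real.exp (-((∑ i, (rep ((z - z').1 i) +
      ((Equiv.subRight j (-k)) i : ℤ)) ^ 2) + ‖(z - z').2‖ ^ 2) / (4 * t))) =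
      ENNReal.ofReal (Real.exp (-dist (lift k z') (lift 0 z) ^ 2 / (4 * t))) := by
    intro k
    rw [dist_lift_sq]
    have h2 : ∑ i, (rep ((z - z').1 i) + ((Equiv.subRight j (-k)) i : ℤ)) ^ 2 =
        ∑ i, (rep (z.1 i) - rep (z'.1 i) + (((0 : Fin n → ℤ) i : ℤ) - k i)) ^ 2 := by
      refine Finset.sum_congr rfl fun i _ => ?_
      rw [hj]
      simp only [Equiv.subRight_apply, Pi.sub_apply, Pi.neg_apply, Pi.zero_apply]
      push_cast
      ring
    rw [h2, Prod.snd_sub]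
  -- The reindexing `k ↦ -k - j` cancels the integer defect `j` and matches the cell `k`.
  rw [← ((Equiv.neg (Fin n → ℤ)).trans (Equiv.subRight j)).tsum_eq]
  simp only [Equiv.trans_apply, Equiv.neg_apply, h]
  exact ENNReal.sum_le_tsum _

/-- All representatives lie in `[-1/2, 1/2)`, so the integer defect `j` has entries in `{-1, 0, 1}`.
The flat distance is therefore attained at the neighbouring cell `-j`, and one term of `nearSum` is
enough. -/
lemma eKernel_sub_le {t R : ℝ} (ht : 0 < t) (htR : t ≤ R) (z z' : Waveguide n m) :
    eKernel t (z - z') ≤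
      thetaConst R ^ n * (ENNReal.ofReal (normFactor n m t) * nearSum t z z') := by
  obtain ⟨j, hj⟩ := exists_rep_sub_fst z z'
  refine (eKernel_le ht htR (z - z')).trans ?_
  gcongr
  have hmem : -j ∈ shifts n := by
    have h1 : ∀ i, -1 ≤ j i ∧ j i ≤ 1 := by
      intro i
      have h2 := hj i
      have h3 := rep_mem ((z - z').1 i)
      have h4 := rep_mem (z.1 i)
      have h5 := rep_mem (z'.1 i)
      have h6 : (-2 : ℝ) < j i := by linarith
      have h7 : (j i : ℝ) < 2 := by linarith
      have h8 : -2 < j i := by exact_mod_cast h6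
      have h9 : j i < 2 := by exact_mod_cast h7
      omega
    refine Finset.mem_Icc.2 ⟨fun i => ?_, fun i => ?_⟩
    · have := h1 i; simp; omega
    · have := h1 i; simp; omega
  have h : sqNorm (z - z') = dist (lift (-j) z') (lift 0 z) ^ 2 := by
    rw [dist_lift_sq, sqNorm]
    congr 1
    refine Finset.sum_congr rfl fun i _ => ?_
    rw [hj]
    simp
  rw [h]
  exact Finset.single_le_sum (f := fun k =>
    ENNReal.ofReal (Real.exp (-dist (lift k z') (lift 0 z) ^ 2 / (4 * t))))
    (fun _ _ => zero_le) hmem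

lemma measurable_exp_dist (t : ℝ) (w : Cover n m) :
    Measurable fun w' : Cover n m => ENNReal.ofReal (Real.exp (-dist w' w ^ 2 / (4 * t))) := by
  fun_prop

lemma lintegral_nearSum_mul (ν : Measure (Waveguide n m)) {h : Waveguide n m → ℝ≥0∞}
    (hh : Measurable h) (t : ℝ) (z : Waveguide n m) :
    ∫⁻ z', nearSum t z z' * h z' ∂ν = ∫⁻ w, h (proj w) *
      ENNReal.ofReal (Real.exp (-dist w (lift 0 z) ^ 2 / (4 * t))) ∂(coverMeasure ν) := by
  rw [lintegral_coverMeasure ν (F := fun w => h (proj w) *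
      ENNReal.ofReal (Real.exp (-dist w (lift 0 z) ^ 2 / (4 * t))))
      ((hh.comp measurable_proj).mul (measurable_exp_dist _ _)), ← lintegral_finsetSum]
  · refine lintegral_congr fun z' => ?_
    simp only [proj_lift, nearSum, Finset.sum_mul]
    exact Finset.sum_congr rfl fun k _ => mul_comm _ _
  · intro k _
    exact ((hh.comp measurable_proj).mul (measurable_exp_dist t (lift 0 z))).comp (measurable_lift k)

/-- The maximal function on the waveguide induced by the centered maximal function on the cover. -/
def maximal (ν : Measure (Waveguide n m)) (h : Waveguide n m → ℝ≥0∞) (z : Waveguide n m) : ℝ≥0∞ :=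
  CenteredMaximal.maximal (coverMeasure ν) (fun w => h (proj w)) (lift 0 z)

lemma measurable_maximal (ν : Measure (Waveguide n m)) [SFinite ν] {h : Waveguide n m → ℝ≥0∞}
    (hh : Measurable h) : Measurable (maximal ν h) :=
  (CenteredMaximal.measurable_maximal _ (hh.comp measurable_proj)).comp (measurable_lift 0)

/-- The lift to the fundamental cell embeds superlevel sets into the cover; conversely integrals
over the cover cost only the number of cells. -/
theorem exists_maximal_weakType (n m : ℕ) :
    ∃ N : ℕ, ∀ (ν : Measure (Waveguide n m)) [SFinite ν] (h : Waveguide n m → ℝ≥0∞), Measurable h →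
      ∀ s : ℝ≥0, s * ν {z | s < maximal ν h z} ≤ N * ∫⁻ z, h z ∂ν := by
  obtain ⟨N, hN⟩ := CenteredMaximal.exists_weakType (Cover n m)
  refine ⟨N * (shifts n).card, fun ν _ h hh s => ?_⟩
  have hm := CenteredMaximal.measurable_maximal (coverMeasure ν) (hh.comp measurable_proj)
  have hS := measurableSet_lt (measurable_const (a := (s : ℝ≥0∞))) hm
  have h1 := lintegral_comp_lift_le ν (measurable_one.indicator hS)
  have hS' : MeasurableSet {z | s < maximal ν h z} := measurable_lift 0 hS
  rw [lintegral_indicator_one hS] at h1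
  calc s * ν {z | s < maximal ν h z} = s * ∫⁻ z, {z | s < maximal ν h z}.indicator 1 z ∂ν := by
        rw [lintegral_indicator_one hS']
    _ ≤ s * coverMeasure ν
        {w | s < CenteredMaximal.maximal (coverMeasure ν) (h ∘ proj) w} := by
        gcongr
        exact h1
    _ ≤ N * ∫⁻ w, h (proj w) ∂(coverMeasure ν) := hN _ _ _
    _ = _ := by rw [lintegral_comp_proj ν hh]; push_cast; ring

theorem exists_maximal_strongType (n m : ℕ) {p : ℝ} (hp : 1 < p) :
    ∃ C : ℝ≥0, ∀ (ν : Measure (Waveguide n m)) [SFinite ν] (h : Waveguide n m → ℝ≥0∞),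
      Measurable h → ∫⁻ z, maximal ν h z ^ p ∂ν ≤ C * ∫⁻ z, h z ^ p ∂ν := by
  obtain ⟨C, hC⟩ := CenteredMaximal.exists_strongType (Cover n m) hp
  refine ⟨C * (shifts n).card, fun ν _ h hh => ?_⟩
  have hm := CenteredMaximal.measurable_maximal (coverMeasure ν) (hh.comp measurable_proj)
  calc ∫⁻ z, maximal ν h z ^ p ∂ν
      ≤ ∫⁻ w, CenteredMaximal.maximal (coverMeasure ν) (h ∘ proj) w ^ p ∂(coverMeasure ν) :=
        lintegral_comp_lift_le ν (hm.pow_const p)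
    _ ≤ C * ∫⁻ w, h (proj w) ^ p ∂(coverMeasure ν) := hC _ _ (hh.comp measurable_proj)
    _ = _ := by
        rw [lintegral_comp_proj ν (hh.pow_const p)]
        push_cast
        ring

/-- Heat averages with respect to a measure are dominated by its maximal function. -/
theorem lintegral_eKernel_mul_le {ν : Measure (Waveguide n m)} [SFinite ν] (hν : FiniteOnSlabs ν)
    {h : Waveguide n m → ℝ≥0∞} (hh : Measurable h) {t R : ℝ} (ht : 0 < t) (htR : t ≤ R)
    (z : Waveguide n m) :
    ∫⁻ z', eKernel t (z - z') * h z' ∂ν ≤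
      thetaConst R ^ n * maximal ν h z * ∫⁻ z', eKernel t (z - z') ∂ν := by
  have hA : thetaConst R ^ n ≠ ∞ :=
    (ENNReal.pow_lt_top (thetaConst_lt_top (ht.trans_le htR))).ne
  have h1 := lintegral_nearSum_mul ν (measurable_const (a := (1 : ℝ≥0∞))) t z
  simp only [mul_one, one_mul] at h1
  calc ∫⁻ z', eKernel t (z - z') * h z' ∂ν
      ≤ ∫⁻ z', (thetaConst R ^ n * ENNReal.ofReal (normFactor n m t)) *
          (nearSum t z z' * h z') ∂ν := by
        refine lintegral_mono fun z' => ?_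
        calc _ ≤ thetaConst R ^ n * (ENNReal.ofReal (normFactor n m t) * nearSum t z z') * h z' := by
              gcongr; exact eKernel_sub_le ht htR z z'
          _ = _ := by ring
    _ = (thetaConst R ^ n * ENNReal.ofReal (normFactor n m t)) *
          ∫⁻ z', nearSum t z z' * h z' ∂ν :=
        lintegral_const_mul' _ _ (ENNReal.mul_ne_top hA ENNReal.ofReal_ne_top)
    _ ≤ (thetaConst R ^ n * ENNReal.ofReal (normFactor n m t)) *
          (maximal ν h z * ∫⁻ z', nearSum t z z' ∂ν) := by
        rw [lintegral_nearSum_mul ν hh, h1]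
        gcongr
        -- Both integrals are now Gaussian averages on the cover against the same lifted measure.
        exact CenteredMaximal.lintegral_mul_exp_le hν.coverMeasure_closedBall_lt_top
          (hh.comp measurable_proj) _ ht
    _ = thetaConst R ^ n * maximal ν h z *
          ∫⁻ z', ENNReal.ofReal (normFactor n m t) * nearSum t z z' ∂ν := by
        rw [lintegral_const_mul' _ _ ENNReal.ofReal_ne_top]; ring
    _ ≤ _ := by
        gcongr with z'
        exact normFactor_mul_nearSum_le t z z'

lemma finiteOnSlabs_volume : FiniteOnSlabs (volume : Measure (Waveguide n m)) := by
  intro r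
  have : {z : Waveguide n m | ‖z.2‖ ≤ r} = univ ×ˢ Metric.closedBall 0 r := by
    ext z; simp
  rw [this]
  exact (isCompact_univ.prod (isCompact_closedBall _ _)).measure_lt_top

/-! ### Gaussian growth and the pointwise majorant. -/

/-- The growing Gaussian weight `e^{a|y|²}`. -/
def growth (a : ℝ) (z : Waveguide n m) : ℝ≥0∞ := ENNReal.ofReal (Real.exp (a * ‖z.2‖ ^ 2))

lemma measurable_growth (a : ℝ) : Measurable (growth a : Waveguide n m → ℝ≥0∞) := by
  unfold growth; fun_prop

lemma growth_mul_growth_neg (a : ℝ) (z : Waveguide n m) : growth a z * growth (-a) z = 1 := by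
  unfold growth
  rw [← ENNReal.ofReal_mul (Real.exp_pos _).le, ← Real.exp_add]
  simp

lemma growth_ne_top (a : ℝ) (z : Waveguide n m) : growth a z ≠ ∞ := ENNReal.ofReal_ne_top

lemma growth_rpow (a : ℝ) {q : ℝ} (hq : 0 ≤ q) (z : Waveguide n m) :
    growth a z ^ q = growth (q * a) z := by
  unfold growth
  rw [ENNReal.ofReal_rpow_of_nonneg (Real.exp_pos _).le hq, ← Real.exp_mul]
  congr 2; ring

lemma norm_sq_le_add (y y' : EuclideanSpace ℝ (Fin m)) :
    ‖y'‖ ^ 2 ≤ 2 * ‖y‖ ^ 2 + 2 * ‖y - y'‖ ^ 2 := by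
  have h : ‖y'‖ ≤ ‖y‖ + ‖y - y'‖ := by
    simpa using norm_sub_le y (y - y')
  nlinarith [norm_nonneg y', sq_nonneg (‖y‖ - ‖y - y'‖), norm_nonneg y, norm_nonneg (y - y')]

/-- The loss in normalization when the time is doubled. -/
def doublingConst (n m : ℕ) : ℝ≥0∞ := ENNReal.ofReal (2 ^ (((n : ℝ) + m) / 2))

lemma normFactor_eq_doubling {t : ℝ} (ht : 0 < t) :
    ENNReal.ofReal (normFactor n m t) =
      doublingConst n m * ENNReal.ofReal (normFactor n m (2 * t)) := by
  rw [doublingConst, ← ENNReal.ofReal_mul (by positivity), normFactor, normFactor]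
  congr 1
  have hpi : 0 < 4 * Real.pi * t := by positivity
  rw [show 4 * Real.pi * (2 * t) = 2 * (4 * Real.pi * t) by ring,
    Real.mul_rpow (x := 2) (by norm_num) hpi.le, ← mul_assoc, ← Real.rpow_add (by norm_num)]
  simp

/-- From `|y'|² ≤ 2|y|² + 2|y - y'|²`, the excess `2a|y - y'|²` is at most half of the exponent `S /
(4t)` precisely because `16at ≤ 1`. The other half is the Gaussian at time `2t`. -/
lemma eKernel_sub_mul_growth_le {a t : ℝ} (ha : 0 < a) (ht : 0 < t) (hat : 16 * a * t ≤ 1)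
    (z z' : Waveguide n m) :
    eKernel t (z - z') * growth a z' ≤
      doublingConst n m * growth (2 * a) z * eKernel (2 * t) (z - z') := by
  unfold eKernel
  rw [normFactor_eq_doubling ht]
  calc _ = doublingConst n m * ENNReal.ofReal (normFactor n m (2 * t)) *
        ∑' k : Fin n → ℤ, ENNReal.ofReal (Real.exp (-((∑ i, (rep ((z - z').1 i) + k i) ^ 2) +
          ‖(z - z').2‖ ^ 2) / (4 * t))) * growth a z' := by
        rw [ENNReal.tsum_mul_right]; ring
    _ ≤ doublingConst n m * ENNReal.ofReal (normFactor n m (2 * t)) *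
        ∑' k : Fin n → ℤ, growth (2 * a) z *
          ENNReal.ofReal (Real.exp (-((∑ i, (rep ((z - z').1 i) + k i) ^ 2) +
          ‖(z - z').2‖ ^ 2) / (4 * (2 * t)))) := by
        refine mul_le_mul' le_rfl (ENNReal.tsum_le_tsum fun k => ?_)
        unfold growth
        rw [← ENNReal.ofReal_mul (Real.exp_pos _).le, ← ENNReal.ofReal_mul (Real.exp_pos _).le,
          ← Real.exp_add, ← Real.exp_add]
        refine ENNReal.ofReal_le_ofReal (Real.exp_le_exp.2 ?_)
        set S := (∑ i, (rep ((z - z').1 i) + k i) ^ 2) + ‖(z - z').2‖ ^ 2 with hS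
        have h1 : ‖z.2 - z'.2‖ ^ 2 ≤ S := by
          have : 0 ≤ ∑ i, (rep ((z - z').1 i) + k i) ^ 2 := by positivity
          rw [hS, Prod.snd_sub]; linarith
        have h2 := norm_sq_le_add z.2 z'.2
        have h3 : 2 * a * S ≤ S / (8 * t) := by
          rw [le_div_iff₀ (by positivity)]
          have : 0 ≤ S := le_trans (by positivity) h1
          nlinarith
        have h4 : a * ‖z'.2‖ ^ 2 ≤ 2 * a * ‖z.2‖ ^ 2 + 2 * a * S := by nlinarith
        have h5 : -S / (4 * t) = -(S / (8 * t)) - S / (8 * t) := by field_simp; ring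
        have h6 : -S / (4 * (2 * t)) = -(S / (8 * t)) := by field_simp; ring
        rw [h5, h6]
        linarith
    _ = _ := by rw [ENNReal.tsum_mul_left]; ring

/-- The constant in the pointwise bound for heat averages. -/
def boundConst (n m : ℕ) (a : ℝ) : ℝ≥0∞ := doublingConst n m * thetaConst (1 / (8 * a)) ^ n

lemma boundConst_ne_top {a : ℝ} (ha : 0 < a) : boundConst n m a ≠ ∞ :=
  ENNReal.mul_ne_top ENNReal.ofReal_ne_top
    (ENNReal.pow_lt_top (thetaConst_lt_top (by positivity))).ne

/-- A pointwise majorant of the heat averages of `F` over small times. -/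
def majorant (a : ℝ) (F : Waveguide n m → ℝ≥0∞) (z : Waveguide n m) : ℝ≥0∞ :=
  boundConst n m a * growth (2 * a) z * maximal volume (fun z => F z * growth (-a) z) z

lemma measurable_majorant (a : ℝ) {F : Waveguide n m → ℝ≥0∞} (hF : Measurable F) :
    Measurable (majorant a F) :=
  ((measurable_growth _).const_mul _).mul (measurable_maximal _ (hF.mul (measurable_growth _)))

/-- Write `F = e^{a|y|²} (F e^{-a|y|²})`, move the growth to the center, and apply the maximal bound
for Lebesgue measure at time `2t ≤ 1/(8a)`, where the kernel has mass one. -/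
lemma lintegral_eKernel_mul_le_majorant {a t : ℝ} (ha : 0 < a) (ht : 0 < t)
    (hat : 16 * a * t ≤ 1) {F : Waveguide n m → ℝ≥0∞} (hF : Measurable F) (z : Waveguide n m) :
    ∫⁻ z', eKernel t (z - z') * F z' ≤ majorant a F z := by
  have htR : 2 * t ≤ 1 / (8 * a) := by
    rw [le_div_iff₀ (by positivity)]; linarith
  have h1 := lintegral_eKernel_mul_le (n := n) (m := m) finiteOnSlabs_volume
    (hF.mul (measurable_growth (-a))) (by positivity : 0 < 2 * t) htR z
  rw [lintegral_eKernel_sub (by positivity), mul_one] at h1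
  calc ∫⁻ z', eKernel t (z - z') * F z'
      ≤ ∫⁻ z', doublingConst n m * growth (2 * a) z *
          (eKernel (2 * t) (z - z') * (F z' * growth (-a) z')) := by
        refine lintegral_mono fun z' => ?_
        calc eKernel t (z - z') * F z'
            = eKernel t (z - z') * growth a z' * (F z' * growth (-a) z') := by
              calc _ = eKernel t (z - z') * F z' * (growth a z' * growth (-a) z') := by
                    rw [growth_mul_growth_neg, mul_one]
                _ = _ := by ring
          _ ≤ doublingConst n m * growth (2 * a) z * eKernel (2 * t) (z - z') *
              (F z' * growth (-a) z') := by
              exact mul_le_mul' (eKernel_sub_mul_growth_le ha ht hat z z') le_rfl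
          _ = _ := by ring
    _ = doublingConst n m * growth (2 * a) z *
          ∫⁻ z', eKernel (2 * t) (z - z') * (F z' * growth (-a) z') :=
        lintegral_const_mul' _ _ (ENNReal.mul_ne_top ENNReal.ofReal_ne_top (growth_ne_top _ _))
    _ ≤ doublingConst n m * growth (2 * a) z * (thetaConst (1 / (8 * a)) ^ n *
          maximal volume (fun z => F z * growth (-a) z) z) := by
        gcongr
        exact h1
    _ = _ := by unfold majorant boundConst; ring

/-- The weak type bound at heights `k → ∞` leaves no mass for the infinite set. -/
lemma ae_maximal_lt_top {ν : Measure (Waveguide n m)} [SFinite ν] {h : Waveguide n m → ℝ≥0∞}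
    (hh : Measurable h) (hfin : ∫⁻ z, h z ∂ν ≠ ∞) : ∀ᵐ z ∂ν, maximal ν h z < ∞ := by
  obtain ⟨N, hN⟩ := exists_maximal_weakType n m
  have hI : N * ∫⁻ z, h z ∂ν ≠ ∞ := ENNReal.mul_ne_top (by simp) hfin
  set S := {z | ¬ maximal ν h z < ∞} with hS
  have h1 : ∀ k : ℕ, k * ν S ≤ N * ∫⁻ z, h z ∂ν := by
    intro k
    refine le_trans ?_ (hN ν h hh k)
    simp only [ENNReal.coe_natCast]
    gcongr
    intro z hz
    have : maximal ν h z = ∞ := by simpa [hS] using hz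
    simp [this]
  rw [ae_iff]
  by_contra h0
  obtain ⟨k, hk⟩ := ENNReal.exists_nat_mul_gt h0 hI
  exact absurd (h1 k) (not_le.2 hk)

lemma ae_majorant_lt_top {a : ℝ} (ha : 0 < a) {F : Waveguide n m → ℝ≥0∞} (hF : Measurable F)
    (hfin : ∫⁻ z, F z * growth (-a) z ≠ ∞) : ∀ᵐ z, majorant a F z < ∞ := by
  filter_upwards [ae_maximal_lt_top (hF.mul (measurable_growth (-a))) hfin] with z hz
  exact ENNReal.mul_lt_top
    (ENNReal.mul_lt_top (boundConst_ne_top ha).lt_top (growth_ne_top _ _).lt_top) hz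

/-! ### Convolutions and the maximal operator through integrals in `[0, ∞]`. -/

lemma measurable_heatKernel {t : ℝ} (ht : 0 < t) :
    Measurable (heatKernel t : Waveguide n m → ℝ) := by
  have : (heatKernel t : Waveguide n m → ℝ) = fun z => (eKernel t z).toReal :=
    funext fun z => (eKernel_toReal ht z).symm
  rw [this]
  exact (measurable_eKernel t).ennreal_toReal

lemma heatKernel_nonneg {t : ℝ} (ht : 0 < t) (z : Waveguide n m) : 0 ≤ heatKernel t z := by
  rw [← eKernel_toReal ht]; exact ENNReal.toReal_nonneg

lemma enorm_heatKernel {t : ℝ} (ht : 0 < t) (z : Waveguide n m) :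
    ‖(heatKernel t z : ℂ)‖ₑ = eKernel t z := by
  rw [← ofReal_norm, Complex.norm_real, Real.norm_of_nonneg (heatKernel_nonneg ht z),
    ofReal_heatKernel ht]

lemma measurable_eKernel_sub (t : ℝ) (z : Waveguide n m) :
    Measurable fun z' : Waveguide n m => eKernel t (z - z') :=
  (measurable_eKernel t).comp (measurable_id.const_sub z)

lemma aestronglyMeasurable_heatKernel_mul {t : ℝ} (ht : 0 < t) {f : Waveguide n m → ℂ}
    (hf : AEStronglyMeasurable f volume) (z : Waveguide n m) :
    AEStronglyMeasurable (fun z' => (heatKernel t (z - z') : ℂ) * f z') volume := by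
  refine AEStronglyMeasurable.mul ?_ hf
  exact (Complex.measurable_ofReal.comp
    ((measurable_heatKernel ht).comp (measurable_id.const_sub z))).aestronglyMeasurable

lemma heatConvFinite_iff {t : ℝ} (ht : 0 < t) {f : Waveguide n m → ℂ}
    (hf : AEStronglyMeasurable f volume) (z : Waveguide n m) :
    HeatConvFinite t f z ↔ ∫⁻ z', eKernel t (z - z') * ‖f z'‖ₑ < ∞ := by
  unfold HeatConvFinite Integrable HasFiniteIntegral
  simp only [enorm_mul, enorm_heatKernel ht]
  exact ⟨fun h => h.2, fun h => ⟨aestronglyMeasurable_heatKernel_mul ht hf z, h⟩⟩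

lemma absHeatConv_le {t : ℝ} (ht : 0 < t) {f : Waveguide n m → ℂ}
    (hf : AEStronglyMeasurable f volume) (z : Waveguide n m) :
    absHeatConv t f z ≤ ∫⁻ z', eKernel t (z - z') * ‖f z'‖ₑ := by
  unfold absHeatConv
  split_ifs with h
  · refine (enorm_integral_le_lintegral_enorm _).trans (le_of_eq ?_)
    simp only [enorm_mul, enorm_heatKernel ht]
  · rw [heatConvFinite_iff ht hf, not_lt, top_le_iff] at h
    rw [h]

/-- The convention `∞` for divergent integrals lets one bad time `t < R` decide the supremum; the
converse implications use this. -/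
lemma heatMaximal_eq_top {t R : ℝ} (ht : 0 < t) (htR : t < R) {f : Waveguide n m → ℂ}
    (hf : AEStronglyMeasurable f volume) {z : Waveguide n m}
    (h : ∫⁻ z', eKernel t (z - z') * ‖f z'‖ₑ = ∞) : heatMaximal R f z = ∞ := by
  have h1 : absHeatConv t f z = ∞ := by
    unfold absHeatConv
    rw [if_neg]
    rw [heatConvFinite_iff ht hf, h]
    simp
  rw [eq_top_iff, ← h1]
  exact le_iSup₂ (f := fun (t : ℝ) (_ : t ∈ Ioo (0 : ℝ) R) => absHeatConv t f z) t ⟨ht, htR⟩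

lemma exists_measurable_enorm {f : Waveguide n m → ℂ} (hf : AEStronglyMeasurable f volume) :
    ∃ F : Waveguide n m → ℝ≥0∞, Measurable F ∧ ∀ᵐ z, ‖f z‖ₑ = F z :=
  ⟨hf.enorm.mk _, hf.enorm.measurable_mk, hf.enorm.ae_eq_mk⟩

lemma heatMaximal_le {R : ℝ} {f : Waveguide n m → ℂ} (hf : AEStronglyMeasurable f volume)
    {F : Waveguide n m → ℝ≥0∞} (hF : ∀ᵐ z, ‖f z‖ₑ = F z) {z : Waveguide n m} {B : ℝ≥0∞}
    (hB : ∀ t, 0 < t → t < R → ∫⁻ z', eKernel t (z - z') * F z' ≤ B) : heatMaximal R f z ≤ B := by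
  refine iSup₂_le fun t ht => (absHeatConv_le ht.1 hf z).trans (le_trans (le_of_eq ?_)
    (hB t ht.1 ht.2))
  refine lintegral_congr_ae ?_
  filter_upwards [hF] with z' hz'
  rw [hz']

lemma wLpNorm_eq {p : ℝ} (hp : 1 ≤ p) {w : Waveguide n m → ℝ} (hw : IsWeight w)
    (g : Waveguide n m → ℝ≥0∞) :
    wLpNorm p w g = (∫⁻ z, g z ^ p * ENNReal.ofReal (w z)) ^ (1 / p) := by
  have hp0 : 0 < p := by linarith
  unfold wLpNorm
  rw [eLpNorm_eq_lintegral_rpow_enorm_toReal (by simpa using hp0) ENNReal.ofReal_ne_top,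
    ENNReal.toReal_ofReal hp0.le]
  congr 1
  refine lintegral_congr fun z => ?_
  rw [enorm_eq_self, ENNReal.mul_rpow_of_nonneg _ _ hp0.le,
    ENNReal.ofReal_rpow_of_nonneg (Real.rpow_nonneg (hw.pos z).le _) hp0.le,
    ← Real.rpow_mul (hw.pos z).le, one_div, inv_mul_cancel₀ hp0.ne', Real.rpow_one]

/-! ### The class `D_p` and Hölder's inequality. -/

/-- The weight occurring in the class `D_p` without the Gaussian factor. -/
def dualWeight (p : ℝ) (v : Waveguide n m → ℝ) (z : Waveguide n m) : ℝ≥0∞ :=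
  ENNReal.ofReal (v z ^ (-(1 / p)))

lemma measurable_dualWeight (p : ℝ) {v : Waveguide n m → ℝ} (hv : IsWeight v) :
    Measurable (dualWeight p v) :=
  (hv.measurable.pow_const _).ennreal_ofReal

lemma conjExponent_ofReal {p : ℝ} (hp : 1 < p) :
    ENNReal.conjExponent (ENNReal.ofReal p) = ENNReal.ofReal (p / (p - 1)) := by
  have hp' : 0 < p - 1 := by linarith
  rw [ENNReal.conjExponent, ← ENNReal.ofReal_one, ← ENNReal.ofReal_sub _ zero_le_one,
    ← ENNReal.ofReal_inv_of_pos hp', ← ENNReal.ofReal_add zero_le_one (by positivity)]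
  congr 1
  field_simp
  ring

/-- With `a = 1/(4t₀)` the exponents `p' = ∞` and `p' < ∞` are separated into an essential bound and
an integral. -/
lemma memDWG_iff {p : ℝ} (hp : 1 ≤ p) {v : Waveguide n m → ℝ} (hv : IsWeight v) :
    MemDWG p v ↔ ∃ a : ℝ, 0 < a ∧
      (p = 1 → ∃ C : ℝ≥0, ∀ᵐ z, dualWeight p v z * growth (-a) z ≤ C) ∧
      (1 < p → ∫⁻ z, (dualWeight p v z * growth (-a) z) ^ (p / (p - 1)) < ∞) := by
  have key : ∀ t₀ : ℝ, 0 < t₀ → (MemLp (fun z : Waveguide n m => v z ^ (-(1 / p)) *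
      Real.exp (-‖z.2‖ ^ 2 / (4 * t₀))) (ENNReal.conjExponent (ENNReal.ofReal p)) volume ↔
      (p = 1 → ∃ C : ℝ≥0, ∀ᵐ z, dualWeight p v z * growth (-(1 / (4 * t₀))) z ≤ C) ∧
      (1 < p → ∫⁻ z, (dualWeight p v z * growth (-(1 / (4 * t₀))) z) ^ (p / (p - 1)) < ∞)) := by
    intro t₀ ht₀
    have hen : ∀ z : Waveguide n m, ‖v z ^ (-(1 / p)) * Real.exp (-‖z.2‖ ^ 2 / (4 * t₀))‖ₑ =
        dualWeight p v z * growth (-(1 / (4 * t₀))) z := by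
      intro z
      have h0 : 0 ≤ v z ^ (-(1 / p)) := Real.rpow_nonneg (hv.pos z).le _
      rw [enorm_mul, Real.enorm_of_nonneg h0, Real.enorm_of_nonneg (Real.exp_pos _).le,
        dualWeight, growth]
      congr 3; ring
    have hm : AEStronglyMeasurable (fun z : Waveguide n m => v z ^ (-(1 / p)) *
        Real.exp (-‖z.2‖ ^ 2 / (4 * t₀))) volume :=
      ((hv.measurable.pow_const _).mul (by fun_prop)).aestronglyMeasurable
    rcases hp.eq_or_lt with rfl | hp1
    · simp only [lt_irrefl, false_imp_iff, and_true, true_imp_iff]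
      have : ENNReal.conjExponent (ENNReal.ofReal 1) = ∞ := by simp [ENNReal.conjExponent]
      rw [this]
      constructor
      · intro h
        have h2 := h.2
        rw [eLpNorm_exponent_top] at h2
        refine ⟨(eLpNormEssSup (fun z : Waveguide n m => v z ^ (-(1 / 1 : ℝ)) *
          Real.exp (-‖z.2‖ ^ 2 / (4 * t₀))) volume).toNNReal, ?_⟩
        filter_upwards [ae_le_eLpNormEssSup (f := fun z : Waveguide n m => v z ^ (-(1 / 1 : ℝ)) *
          Real.exp (-‖z.2‖ ^ 2 / (4 * t₀))) (μ := volume)] with z hz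
        rw [← hen, ENNReal.coe_toNNReal h2.ne]
        exact hz
      · rintro ⟨C, hC⟩
        refine ⟨hm, ?_⟩
        rw [eLpNorm_exponent_top]
        refine lt_of_le_of_lt (essSup_le_of_ae_le (C : ℝ≥0∞) ?_) ENNReal.coe_lt_top
        filter_upwards [hC] with z hz
        rw [hen]; exact hz
    · have hq : 0 < p / (p - 1) := div_pos (by linarith) (by linarith)
      rw [conjExponent_ofReal hp1]
      simp only [hp1.ne', false_imp_iff, true_and, hp1, true_imp_iff]
      rw [MemLp, and_iff_right hm, eLpNorm_lt_top_iff_lintegral_rpow_enorm_lt_top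
        (by simpa using hq) ENNReal.ofReal_ne_top, ENNReal.toReal_ofReal hq.le]
      simp_rw [hen]
  constructor
  · rintro ⟨t₀, ht₀, h⟩
    exact ⟨1 / (4 * t₀), by positivity, (key t₀ ht₀).1 h⟩
  · rintro ⟨a, ha, h⟩
    refine ⟨1 / (4 * a), by positivity, (key _ (by positivity)).2 ?_⟩
    have : 1 / (4 * (1 / (4 * a))) = a := by field_simp
    rwa [this]

lemma dualWeight_mul_rpow (p : ℝ) {v : Waveguide n m → ℝ} (hv : IsWeight v)
    (z : Waveguide n m) : dualWeight p v z * ENNReal.ofReal (v z ^ (1 / p)) = 1 := by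
  rw [dualWeight, ← ENNReal.ofReal_mul (Real.rpow_nonneg (hv.pos z).le _),
    ← Real.rpow_add (hv.pos z)]
  simp

lemma ofReal_rpow_one_div_rpow {p x : ℝ} (hp : 0 < p) (hx : 0 < x) :
    ENNReal.ofReal (x ^ (1 / p)) ^ p = ENNReal.ofReal x := by
  rw [ENNReal.ofReal_rpow_of_nonneg (Real.rpow_nonneg hx.le _) hp.le, ← Real.rpow_mul hx.le,
    one_div, inv_mul_cancel₀ hp.ne', Real.rpow_one]

/-- Hölder's inequality for weights in `D_p`. -/
lemma MemDWG.exists_lintegral_le {p : ℝ} (hp : 1 ≤ p) {v : Waveguide n m → ℝ} (hv : IsWeight v)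
    (h : MemDWG p v) : ∃ a : ℝ, 0 < a ∧ ∃ C : ℝ≥0, ∀ F : Waveguide n m → ℝ≥0∞, Measurable F →
      ∫⁻ z, F z * growth (-a) z ≤ C * (∫⁻ z, F z ^ p * ENNReal.ofReal (v z)) ^ (1 / p) := by
  have hp0 : 0 < p := by linarith
  obtain ⟨a, ha, h1, h2⟩ := (memDWG_iff hp hv).1 h
  refine ⟨a, ha, ?_⟩
  have hmv : Measurable fun z : Waveguide n m => ENNReal.ofReal (v z ^ (1 / p)) :=
    (hv.measurable.pow_const _).ennreal_ofReal
  have heq : ∀ (F : Waveguide n m → ℝ≥0∞) z, F z * growth (-a) z =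
      (F z * ENNReal.ofReal (v z ^ (1 / p))) * (dualWeight p v z * growth (-a) z) := by
    intro F z
    calc _ = F z * (dualWeight p v z * ENNReal.ofReal (v z ^ (1 / p))) * growth (-a) z := by
          rw [dualWeight_mul_rpow p hv, mul_one]
      _ = _ := by ring
  rcases hp.eq_or_lt with rfl | hp1
  · obtain ⟨C, hC⟩ := h1 rfl
    refine ⟨C, fun F hF => ?_⟩
    simp only [ENNReal.rpow_one, div_one]
    rw [← lintegral_const_mul' _ _ ENNReal.coe_ne_top]
    refine lintegral_mono_ae ?_
    filter_upwards [hC] with z hz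
    rw [heq]
    simp only [div_one, Real.rpow_one]
    rw [mul_comm]
    gcongr
  · have hpq : p.HolderConjugate (p / (p - 1)) := Real.HolderConjugate.conjExponent hp1
    have hfin := h2 hp1
    set q := p / (p - 1) with hq
    refine ⟨((∫⁻ z, (dualWeight p v z * growth (-a) z) ^ q) ^ (1 / q)).toNNReal, fun F hF => ?_⟩
    rw [ENNReal.coe_toNNReal (ENNReal.rpow_ne_top_of_nonneg hpq.symm.one_div_nonneg hfin.ne),
      mul_comm]
    have := ENNReal.lintegral_mul_le_Lp_mul_Lq volume hpq (hF.mul hmv).aemeasurable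
      ((measurable_dualWeight p hv).mul (measurable_growth (-a))).aemeasurable
    simp only [Pi.mul_apply] at this
    refine le_trans (le_of_eq (lintegral_congr (heq F))) (this.trans (le_of_eq ?_))
    congr 2
    refine lintegral_congr fun z => ?_
    rw [ENNReal.mul_rpow_of_nonneg _ _ hp0.le, ofReal_rpow_one_div_rpow hp0 (hv.pos z)]

/-- On a slab the factor `e^{-a|y|²}` is bounded below by `e^{-ar²}`. -/
lemma finiteOnSlabs_withDensity {h : Waveguide n m → ℝ≥0∞} {a : ℝ}
    (ha : 0 < a) (hfin : ∫⁻ z, h z * growth (-a) z < ∞) :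
    FiniteOnSlabs ((volume : Measure (Waveguide n m)).withDensity h) := by
  intro r
  have hS : MeasurableSet {z : Waveguide n m | ‖z.2‖ ≤ r} :=
    measurableSet_le (by fun_prop) measurable_const
  rw [withDensity_apply _ hS]
  calc ∫⁻ z in {z : Waveguide n m | ‖z.2‖ ≤ r}, h z
      ≤ ∫⁻ z in {z : Waveguide n m | ‖z.2‖ ≤ r},
          ENNReal.ofReal (Real.exp (a * r ^ 2)) * (h z * growth (-a) z) := by
        refine setLIntegral_mono' hS fun z hz => ?_
        have hz' : ‖z.2‖ ≤ r := hz
        calc h z = growth a z * (h z * growth (-a) z) := by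
              rw [mul_left_comm, growth_mul_growth_neg, mul_one]
          _ ≤ _ := by
              unfold growth
              gcongr
    _ = ENNReal.ofReal (Real.exp (a * r ^ 2)) *
          ∫⁻ z in {z : Waveguide n m | ‖z.2‖ ≤ r}, h z * growth (-a) z :=
        lintegral_const_mul' _ _ ENNReal.ofReal_ne_top
    _ ≤ ENNReal.ofReal (Real.exp (a * r ^ 2)) * ∫⁻ z, h z * growth (-a) z := by
        gcongr; exact Measure.restrict_le_self
    _ < ∞ := ENNReal.mul_lt_top ENNReal.ofReal_lt_top hfin

/-! ### Sufficiency of `D_p` for the maximal operator. -/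

/-- The times for which the pointwise majorant with parameter `a` is available. -/
def timeBound (a : ℝ) : ℝ := min (1 / 4) (1 / (16 * a))

lemma timeBound_pos {a : ℝ} (ha : 0 < a) : 0 < timeBound a := by
  unfold timeBound; positivity

lemma timeBound_lt_half (a : ℝ) : timeBound a < 1 / 2 :=
  (min_le_left _ _).trans_lt (by norm_num)

lemma mul_le_one_of_le_timeBound {a t : ℝ} (ha : 0 < a) (ht : t ≤ timeBound a) :
    16 * a * t ≤ 1 := by
  have := ht.trans (min_le_right _ _)
  rwa [le_div_iff₀ (by positivity), mul_comm] at this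

lemma heatMaximal_le_majorant {a : ℝ} (ha : 0 < a) {f : Waveguide n m → ℂ}
    (hf : AEStronglyMeasurable f volume) {F : Waveguide n m → ℝ≥0∞} (hFm : Measurable F)
    (hF : ∀ᵐ z, ‖f z‖ₑ = F z) (z : Waveguide n m) :
    heatMaximal (timeBound a) f z ≤ majorant a F z :=
  heatMaximal_le hf hF fun _ ht0 htR => lintegral_eKernel_mul_le_majorant ha ht0
    (mul_le_one_of_le_timeBound ha htR.le) hFm z

lemma lintegral_rpow_mul_eq_wLpNorm {p : ℝ} (hp : 1 ≤ p) {v : Waveguide n m → ℝ} (hv : IsWeight v)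
    {f : Waveguide n m → ℂ} {F : Waveguide n m → ℝ≥0∞} (hF : ∀ᵐ z, ‖f z‖ₑ = F z) :
    (∫⁻ z, F z ^ p * ENNReal.ofReal (v z)) ^ (1 / p) = wLpNorm p v fun z => ‖f z‖ₑ := by
  rw [wLpNorm_eq hp hv]
  congr 1
  refine lintegral_congr_ae ?_
  filter_upwards [hF] with z hz
  rw [hz]

/-- Hölder's inequality gives `|f| e^{-a|y|²} ∈ L¹`, which makes the majorant finite almost
everywhere. -/
theorem MemDWG.ae_heatMaximal_lt_top {p : ℝ} (hp : 1 ≤ p) {v : Waveguide n m → ℝ} (hv : IsWeight v)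
    (h : MemDWG p v) : ∃ R : ℝ, 0 < R ∧ R < 1 / 2 ∧ ∀ f : Waveguide n m → ℂ, MemWLp p v f →
      ∀ᵐ z, heatMaximal R f z < ∞ := by
  obtain ⟨a, ha, C, hC⟩ := h.exists_lintegral_le hp hv
  refine ⟨timeBound a, timeBound_pos ha, timeBound_lt_half a, fun f hf => ?_⟩
  obtain ⟨F, hFm, hF⟩ := exists_measurable_enorm hf.1
  have h1 := hC F hFm
  rw [lintegral_rpow_mul_eq_wLpNorm hp hv hF] at h1
  filter_upwards [ae_majorant_lt_top ha hFm
    (h1.trans_lt (ENNReal.mul_lt_top ENNReal.coe_lt_top hf.2)).ne] with z hz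
  exact (heatMaximal_le_majorant ha hf.1 hFm hF z).trans_lt hz

/-- A weight that turns a weak type bound for `G` into a weak type bound for `κ G`. -/
lemma exists_weight_weakType {κ : Waveguide n m → ℝ} (hκ : Measurable κ) :
    ∃ u : Waveguide n m → ℝ, IsWeight u ∧ ∀ (G : Waveguide n m → ℝ≥0∞) (I : ℝ≥0∞), Measurable G →
      (∀ s : ℝ≥0, s * volume {z | s < G z} ≤ I) → ∀ s : ℝ, 0 < s →
        ∫⁻ z in {z | ENNReal.ofReal s < ENNReal.ofReal (κ z) * G z}, ENNReal.ofReal (u z) ≤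
          2 * I / ENNReal.ofReal s := by
  have hj : Measurable fun z => ⌈κ z⌉₊ := Nat.measurable_ceil.comp hκ
  -- On the piece `⌈κ⌉₊ = j` one has `κ ≤ j + 1`, so height `s` for `κ G` means height `s / (j + 1)`
  -- for `G`. The denominator of `u` repays this loss and `2^{-j}` makes the pieces summable, with
  -- total `2`. Using `j + 1` avoids dividing by zero at `j = 0`.
  refine ⟨fun z => (1 / 2) ^ ⌈κ z⌉₊ / ((⌈κ z⌉₊ : ℝ) + 1), ⟨?_, fun z => by positivity⟩, ?_⟩
  · exact (measurable_from_nat (f := fun j : ℕ => (1 / 2 : ℝ) ^ j / ((j : ℝ) + 1))).comp hj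
  intro G I hG hGI s hs
  have hs0 : ENNReal.ofReal s ≠ 0 := by simpa using hs
  set S := {z | ENNReal.ofReal s < ENNReal.ofReal (κ z) * G z} with hS
  have hcov : S = ⋃ j : ℕ, S ∩ {z | ⌈κ z⌉₊ = j} := by
    ext z; simp
  have hterm : ∀ j : ℕ, ∫⁻ z in S ∩ {z | ⌈κ z⌉₊ = j},
      ENNReal.ofReal ((1 / 2) ^ ⌈κ z⌉₊ / ((⌈κ z⌉₊ : ℝ) + 1)) ≤
        2⁻¹ ^ j * (I / ENNReal.ofReal s) := by
    intro j
    have hSm : MeasurableSet S :=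
      measurableSet_lt measurable_const (hκ.ennreal_ofReal.mul hG)
    have hm : MeasurableSet (S ∩ {z | ⌈κ z⌉₊ = j}) := hSm.inter (hj (measurableSet_singleton j))
    set s' : ℝ≥0 := (s / (j + 1)).toNNReal with hs'
    have hsj : (0 : ℝ) < s / (j + 1) := by positivity
    have hs'0 : (s' : ℝ≥0∞) ≠ 0 := by simp [hs', hsj]
    have hsub : S ∩ {z | ⌈κ z⌉₊ = j} ⊆ {z | s' < G z} := by
      rintro z ⟨hz1, hz2⟩
      have hz1' : ENNReal.ofReal s < ENNReal.ofReal (κ z) * G z := hz1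
      have hz2' : ⌈κ z⌉₊ = j := hz2
      have hle : κ z ≤ (j : ℝ) + 1 := by
        rw [← hz2']; linarith [Nat.le_ceil (κ z)]
      by_contra hcon
      have hcon' : G z ≤ s' := not_lt.1 hcon
      refine absurd hz1' (not_lt.2 ?_)
      calc ENNReal.ofReal (κ z) * G z ≤ ENNReal.ofReal ((j : ℝ) + 1) * ENNReal.ofReal (s / (j + 1)) := by
            gcongr
            exact hcon'
        _ = ENNReal.ofReal s := by
            rw [← ENNReal.ofReal_mul (by positivity)]
            congr 1; field_simp
    have hvol : volume (S ∩ {z | ⌈κ z⌉₊ = j}) ≤ I / s' := by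
      rw [ENNReal.le_div_iff_mul_le (Or.inl hs'0) (Or.inl ENNReal.coe_ne_top), mul_comm]
      exact le_trans (by gcongr) (hGI s')
    calc _ = ∫⁻ z in S ∩ {z | ⌈κ z⌉₊ = j}, ENNReal.ofReal ((1 / 2) ^ j / ((j : ℝ) + 1)) := by
          refine setLIntegral_congr_fun hm ?_
          rintro z ⟨-, hz⟩
          have hz' : ⌈κ z⌉₊ = j := hz
          simp only [hz']
      _ = ENNReal.ofReal ((1 / 2) ^ j / ((j : ℝ) + 1)) * volume (S ∩ {z | ⌈κ z⌉₊ = j}) :=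
          setLIntegral_const _ _
      _ ≤ ENNReal.ofReal ((1 / 2) ^ j / ((j : ℝ) + 1)) * (I / s') := by gcongr
      _ = 2⁻¹ ^ j * (I / ENNReal.ofReal s) := by
          have h1 : (2⁻¹ : ℝ≥0∞) ^ j = ENNReal.ofReal ((1 / 2) ^ j) := by
            rw [ENNReal.ofReal_pow (by norm_num), one_div, ENNReal.ofReal_inv_of_pos (by norm_num),
              ENNReal.ofReal_ofNat]
          have h2 : (s' : ℝ≥0∞) = ENNReal.ofReal (s / (j + 1)) := rfl
          rw [h1, h2, div_eq_mul_inv I, div_eq_mul_inv I, ← ENNReal.ofReal_inv_of_pos hsj,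
            ← ENNReal.ofReal_inv_of_pos hs, mul_left_comm, mul_left_comm _ I,
            ← ENNReal.ofReal_mul (by positivity), ← ENNReal.ofReal_mul (by positivity)]
          congr 2
          field_simp
  calc _ ≤ ∑' j : ℕ, ∫⁻ z in S ∩ {z | ⌈κ z⌉₊ = j},
        ENNReal.ofReal ((1 / 2) ^ ⌈κ z⌉₊ / ((⌈κ z⌉₊ : ℝ) + 1)) := by
        conv_lhs => rw [hcov]
        exact lintegral_iUnion_le _ _
    _ ≤ ∑' j : ℕ, 2⁻¹ ^ j * (I / ENNReal.ofReal s) := ENNReal.tsum_le_tsum hterm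
    _ = 2 * I / ENNReal.ofReal s := by
        rw [ENNReal.tsum_mul_right, ENNReal.tsum_geometric, ENNReal.one_sub_inv_two, inv_inv,
          mul_div_assoc]

/-- In the majorant only the factor `e^{2a|y|²}` spoils the weak type bound, and
`exists_weight_weakType` absorbs it. -/
theorem MemDWG.exists_maximalWeakType {v : Waveguide n m → ℝ} (hv : IsWeight v)
    (h : MemDWG 1 v) : ∃ R : ℝ, 0 < R ∧ R < 1 / 2 ∧ ∃ u : Waveguide n m → ℝ, IsWeight u ∧
      MaximalWeakType R v u := by
  obtain ⟨a, ha, C, hC⟩ := h.exists_lintegral_le le_rfl hv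
  obtain ⟨N, hN⟩ := exists_maximal_weakType n m
  set κ : Waveguide n m → ℝ := fun z =>
    (boundConst n m a).toReal * Real.exp (2 * a * ‖z.2‖ ^ 2) with hκ
  obtain ⟨u, hu, hweak⟩ := exists_weight_weakType (n := n) (m := m) (κ := κ) (by fun_prop)
  refine ⟨timeBound a, timeBound_pos ha, timeBound_lt_half a, u, hu, 2 * N * C,
    fun f hf s hs => ?_⟩
  obtain ⟨F, hFm, hF⟩ := exists_measurable_enorm hf.1
  have h1 := hC F hFm
  rw [lintegral_rpow_mul_eq_wLpNorm le_rfl hv hF] at h1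
  have hgm : Measurable fun z => F z * growth (-a) z := hFm.mul (measurable_growth (-a))
  have h2 := hweak (maximal volume fun z => F z * growth (-a) z) _
    (measurable_maximal _ hgm) (hN volume _ hgm) s hs
  calc _ ≤ ∫⁻ z in {z | ENNReal.ofReal s < ENNReal.ofReal (κ z) *
        maximal volume (fun z => F z * growth (-a) z) z}, ENNReal.ofReal (u z) := by
        refine lintegral_mono_set fun z hz => ?_
        refine lt_of_lt_of_le (show ENNReal.ofReal s < heatMaximal (timeBound a) f z from hz) ?_
        refine (heatMaximal_le_majorant ha hf.1 hFm hF z).trans (le_of_eq ?_)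
        rw [majorant, hκ, ENNReal.ofReal_mul ENNReal.toReal_nonneg,
          ENNReal.ofReal_toReal (boundConst_ne_top ha), growth]
    _ ≤ 2 * (N * ∫⁻ z, F z * growth (-a) z) / ENNReal.ofReal s := h2
    _ ≤ 2 * (N * (C * wLpNorm 1 v fun z => ‖f z‖ₑ)) / ENNReal.ofReal s := by gcongr
    _ = _ := by
        push_cast
        simp only [div_eq_mul_inv]
        ring

/-- The density of the dual measure of a weight. -/
def dualDensity (p : ℝ) (v : Waveguide n m → ℝ) (z : Waveguide n m) : ℝ := v z ^ (-(1 / (p - 1)))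

lemma ofReal_dualDensity {p : ℝ} (hp : 1 < p) {v : Waveguide n m → ℝ} (hv : IsWeight v)
    (z : Waveguide n m) :
    ENNReal.ofReal (dualDensity p v z) = dualWeight p v z ^ (p / (p - 1)) := by
  have hp' : 0 < p - 1 := by linarith
  rw [dualWeight, dualDensity, ENNReal.ofReal_rpow_of_nonneg (Real.rpow_nonneg (hv.pos z).le _)
    (by positivity), ← Real.rpow_mul (hv.pos z).le]
  congr 2
  field_simp

/-- The identity `σ^{1-p} = v` makes `F ↦ F/σ` an isometry from `L^p_v` to `L^p(σ dz)`. -/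
lemma dualDensity_mul_rpow {p : ℝ} (hp : 1 < p) {v : Waveguide n m → ℝ} (hv : IsWeight v)
    (z : Waveguide n m) :
    ENNReal.ofReal (dualDensity p v z) * (ENNReal.ofReal (dualDensity p v z))⁻¹ ^ p =
      ENNReal.ofReal (v z) := by
  have hp' : 0 < p - 1 := by linarith
  have hv0 := hv.pos z
  have h0 : 0 < dualDensity p v z := Real.rpow_pos_of_pos hv0 _
  rw [← ENNReal.ofReal_inv_of_pos h0, ENNReal.ofReal_rpow_of_nonneg (by positivity) (by linarith),
    ← ENNReal.ofReal_mul h0.le, dualDensity, ← Real.rpow_neg hv0.le, ← Real.rpow_mul hv0.le,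
    ← Real.rpow_add hv0]
  congr 1
  have : -(1 / (p - 1)) + - -(1 / (p - 1)) * p = 1 := by field_simp; ring
  rw [this, Real.rpow_one]

/-- The maximal function of the dual measure `ν = σ dz` is bounded on `L^p(ν)` without any doubling.
The Gaussian mass of `ν`, which replaces the mass one of Lebesgue measure, is controlled by `D` and
divided out through `u`. -/
theorem MemDWG.exists_maximalStrongType {p : ℝ} (hp : 1 < p) {v : Waveguide n m → ℝ}
    (hv : IsWeight v) (h : MemDWG p v) :
    ∃ R : ℝ, 0 < R ∧ R < 1 / 2 ∧ ∃ u : Waveguide n m → ℝ, IsWeight u ∧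
      MaximalStrongType p R v u := by
  have hp0 : 0 < p := by linarith
  have hp' : 0 < p - 1 := by linarith
  obtain ⟨a, ha, -, h2⟩ := (memDWG_iff hp.le hv).1 h
  have hfin := h2 hp
  -- Raising the dual weight to the power `p'` multiplies the Gaussian rate by `p'`.
  set b := p / (p - 1) * a with hb
  have hb0 : 0 < b := by positivity
  set σ : Waveguide n m → ℝ≥0∞ := fun z => ENNReal.ofReal (dualDensity p v z) with hσ
  have hσpos : ∀ z, 0 < dualDensity p v z := fun z => Real.rpow_pos_of_pos (hv.pos z) _
  have hdm : Measurable (dualDensity p v) := hv.measurable.pow_const _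
  have hσm : Measurable σ := hdm.ennreal_ofReal
  have hσfin : ∫⁻ z, σ z * growth (-b) z < ∞ := by
    refine lt_of_le_of_lt (le_of_eq (lintegral_congr fun z => ?_)) hfin
    rw [ENNReal.mul_rpow_of_nonneg _ _ (by positivity), growth_rpow _ (by positivity),
      ← ofReal_dualDensity hp hv, hb, mul_neg]
  set ν := (volume : Measure (Waveguide n m)).withDensity σ with hν
  have hslab : FiniteOnSlabs ν := finiteOnSlabs_withDensity hb0 hσfin
  set D := majorant b σ with hD
  have hDm : Measurable D := measurable_majorant b hσm
  obtain ⟨C, hC⟩ := exists_maximal_strongType n m hp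
  set R := timeBound b with hR
  set A := thetaConst R ^ n with hA
  have hAtop : A ≠ ∞ := (ENNReal.pow_lt_top (thetaConst_lt_top (timeBound_pos hb0))).ne
  -- Chosen so that `D^p u ≤ σ` wherever `D` is finite; the summand `1` guards against `D = 0`.
  set u : Waveguide n m → ℝ := fun z => dualDensity p v z / (1 + (D z).toReal) ^ p with hu
  have huw : IsWeight u := by
    refine ⟨hdm.div ((hDm.ennreal_toReal.const_add 1).pow_const p), fun z => ?_⟩
    have : 0 < 1 + (D z).toReal := by positivity
    exact div_pos (hσpos z) (Real.rpow_pos_of_pos this _)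
  have hDu : ∀ z, D z < ∞ → D z ^ p * ENNReal.ofReal (u z) ≤ σ z := by
    intro z hz
    have h1 : 0 < 1 + (D z).toReal := by positivity
    conv_lhs => rw [← ENNReal.ofReal_toReal hz.ne]
    rw [ENNReal.ofReal_rpow_of_nonneg ENNReal.toReal_nonneg hp0.le,
      ← ENNReal.ofReal_mul (by positivity)]
    refine ENNReal.ofReal_le_ofReal ?_
    have h3 : (D z).toReal ^ p ≤ (1 + (D z).toReal) ^ p :=
      Real.rpow_le_rpow ENNReal.toReal_nonneg (by linarith) hp0.le
    rw [hu]
    simp only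
    rw [mul_div_assoc', div_le_iff₀ (by positivity), mul_comm]
    exact mul_le_mul_of_nonneg_left h3 (hσpos z).le
  refine ⟨R, timeBound_pos hb0, timeBound_lt_half b, u, huw,
    ((A ^ p * C) ^ (1 / p)).toNNReal, fun f hf => ?_⟩
  rw [ENNReal.coe_toNNReal (ENNReal.rpow_ne_top_of_nonneg (by positivity)
    (ENNReal.mul_ne_top (ENNReal.rpow_ne_top_of_nonneg hp0.le hAtop) ENNReal.coe_ne_top))]
  obtain ⟨F, hFm, hF⟩ := exists_measurable_enorm hf.1
  set g : Waveguide n m → ℝ≥0∞ := fun z => F z * (σ z)⁻¹ with hg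
  have hgm : Measurable g := hFm.mul hσm.inv
  have hgσ : ∀ z, σ z * g z = F z := fun z => by
    rw [hg]
    simp only
    rw [mul_left_comm, ENNReal.mul_inv_cancel (by simpa [hσ] using hσpos z)
      ENNReal.ofReal_ne_top, mul_one]
  -- The average of `F = σ g` is an average of `g` against `ν`, hence at most `A M_ν g` times the
  -- heat average of `σ`, which is at most `D`.
  have hpoint : ∀ z, heatMaximal R f z ≤ A * maximal ν g z * D z := by
    intro z
    refine heatMaximal_le hf.1 hF fun t ht0 htR => ?_
    have h3 := lintegral_eKernel_mul_le hslab hgm ht0 htR.le z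
    rw [hν, lintegral_withDensity_eq_lintegral_mul _ hσm
      (g := fun z' => eKernel t (z - z') * g z') ((measurable_eKernel_sub t z).mul hgm),
      lintegral_withDensity_eq_lintegral_mul _ hσm (measurable_eKernel_sub t z), ← hν] at h3
    calc ∫⁻ z', eKernel t (z - z') * F z'
        = ∫⁻ z', (σ * fun z' => eKernel t (z - z') * g z') z' := by
          refine lintegral_congr fun z' => ?_
          simp only [Pi.mul_apply]
          rw [mul_left_comm, hgσ]
      _ ≤ _ := h3
      _ ≤ A * maximal ν g z * D z := by
          gcongr
          refine le_trans (le_of_eq (lintegral_congr fun z' => ?_))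
            (lintegral_eKernel_mul_le_majorant hb0 ht0 (mul_le_one_of_le_timeBound hb0 htR.le)
              hσm z)
          exact mul_comm _ _
  rw [wLpNorm_eq hp.le huw, ← lintegral_rpow_mul_eq_wLpNorm hp.le hv hF,
    ← ENNReal.mul_rpow_of_nonneg _ _ (by positivity)]
  refine ENNReal.rpow_le_rpow ?_ (by positivity)
  calc ∫⁻ z, heatMaximal R f z ^ p * ENNReal.ofReal (u z)
      ≤ ∫⁻ z, A ^ p * (σ z * maximal ν g z ^ p) := by
        refine lintegral_mono_ae ?_
        filter_upwards [ae_majorant_lt_top hb0 hσm hσfin.ne] with z hz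
        calc _ ≤ (A * maximal ν g z * D z) ^ p * ENNReal.ofReal (u z) := by
              gcongr; exact hpoint z
          _ = A ^ p * (D z ^ p * ENNReal.ofReal (u z) * maximal ν g z ^ p) := by
              rw [ENNReal.mul_rpow_of_nonneg _ _ hp0.le, ENNReal.mul_rpow_of_nonneg _ _ hp0.le]
              ring
          _ ≤ _ := by gcongr; exact hDu z hz
    _ = A ^ p * ∫⁻ z, maximal ν g z ^ p ∂ν := by
        rw [lintegral_const_mul' _ _ (ENNReal.rpow_ne_top_of_nonneg hp0.le hAtop), hν,
          lintegral_withDensity_eq_lintegral_mul _ hσm ((measurable_maximal _ hgm).pow_const p)]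
        rfl
    _ ≤ A ^ p * (C * ∫⁻ z, g z ^ p ∂ν) := by gcongr; exact hC ν g hgm
    _ = A ^ p * C * ∫⁻ z, F z ^ p * ENNReal.ofReal (v z) := by
        rw [mul_assoc, hν, lintegral_withDensity_eq_lintegral_mul _ hσm (hgm.pow_const p)]
        congr 2
        refine lintegral_congr fun z => ?_
        simp only [Pi.mul_apply, hg]
        rw [ENNReal.mul_rpow_of_nonneg _ _ hp0.le, mul_left_comm, dualDensity_mul_rpow hp hv]

/-! ### Lebesgue points and almost everywhere convergence. -/

/-- Densities pass through the lift because `proj` is a left inverse of every `lift k`. -/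
lemma setLIntegral_coverMeasure (ν : Measure (Waveguide n m)) {h : Waveguide n m → ℝ≥0∞}
    (hh : Measurable h) {S : Set (Cover n m)} (hS : MeasurableSet S) :
    ∫⁻ w in S, h (proj w) ∂(coverMeasure ν) = coverMeasure (ν.withDensity h) S := by
  have h1 : Measurable (S.indicator (1 : Cover n m → ℝ≥0∞)) := measurable_one.indicator hS
  rw [← lintegral_indicator hS, ← lintegral_indicator_one hS, lintegral_coverMeasure _ h1,
    lintegral_coverMeasure ν (F := S.indicator fun w => h (proj w))
      ((hh.comp measurable_proj).indicator hS)]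
  refine Finset.sum_congr rfl fun k _ => ?_
  rw [lintegral_withDensity_eq_lintegral_mul _ hh (g := fun z => S.indicator 1 (lift k z))
    (h1.comp (measurable_lift k))]
  refine lintegral_congr fun z => ?_
  by_cases hz : lift k z ∈ S
  · simp [hz, proj_lift]
  · simp [hz]

lemma locallyIntegrable_comp_proj {f : Waveguide n m → ℂ} (hf : Measurable f) {a : ℝ} (ha : 0 < a)
    (hfin : ∫⁻ z, ‖f z‖ₑ * growth (-a) z < ∞) :
    LocallyIntegrable (fun w => f (proj w)) (coverMeasure volume) := by
  intro w
  refine ⟨Metric.closedBall w 1, Metric.closedBall_mem_nhds w one_pos, ?_, ?_⟩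
  · exact (hf.comp measurable_proj).aestronglyMeasurable
  · unfold HasFiniteIntegral
    rw [setLIntegral_coverMeasure volume hf.enorm Metric.isClosed_closedBall.measurableSet]
    exact (finiteOnSlabs_withDensity ha hfin).coverMeasure_closedBall_lt_top w 1

/-- Differentiation along the Besicovitch family holds for every locally finite measure, in
particular for the lifted one; its null sets pull back to the waveguide under `lift 0`. -/
lemma ae_tendsto_average {f : Waveguide n m → ℂ} (hf : Measurable f) {a : ℝ} (ha : 0 < a)
    (hfin : ∫⁻ z, ‖f z‖ₑ * growth (-a) z < ∞) :
    ∀ᵐ z, Tendsto (fun r => (∫⁻ w in Metric.closedBall (lift 0 z) r, ‖f (proj w) - f z‖ₑ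
      ∂(coverMeasure volume)) / coverMeasure volume (Metric.closedBall (lift 0 z) r))
      (𝓝[>] 0) (𝓝 0) := by
  have : IsLocallyFiniteMeasure (coverMeasure (volume : Measure (Waveguide n m))) :=
    ⟨fun w => ⟨_, Metric.closedBall_mem_nhds w one_pos,
      finiteOnSlabs_volume.coverMeasure_closedBall_lt_top w 1⟩⟩
  have h1 := VitaliFamily.ae_tendsto_lintegral_enorm_sub_div
    (Besicovitch.vitaliFamily (coverMeasure (volume : Measure (Waveguide n m))))
    (locallyIntegrable_comp_proj hf ha hfin)
  filter_upwards [ae_comp_lift h1] with z hz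
  rw [proj_lift] at hz
  exact hz.comp (Besicovitch.tendsto_filterAt _ _)

/-- With `s = 1/t` this is exponential decay against a power of `s`. -/
lemma tendsto_normFactor_mul_exp (n m : ℕ) {δ : ℝ} (hδ : 0 < δ) :
    Tendsto (fun t => ENNReal.ofReal (normFactor n m t * Real.exp (-δ / t))) (𝓝[>] 0) (𝓝 0) := by
  rw [← ENNReal.ofReal_zero]
  refine (ENNReal.continuous_ofReal.tendsto 0).comp ?_
  have h1 := (tendsto_rpow_mul_exp_neg_mul_atTop_nhds_zero (((n : ℝ) + m) / 2) δ hδ).comp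
    tendsto_inv_nhdsGT_zero
  have h2 := h1.const_mul ((4 * Real.pi) ^ (-(((n : ℝ) + m) / 2)))
  rw [mul_zero] at h2
  refine h2.congr' ?_
  filter_upwards [self_mem_nhdsWithin] with t ht
  have ht' : (0 : ℝ) < t := ht
  have h4 : (0 : ℝ) ≤ 4 * Real.pi := by positivity
  simp only [Function.comp]
  rw [normFactor, Real.mul_rpow h4 ht'.le, Real.inv_rpow ht'.le, ← Real.rpow_neg ht'.le,
    div_eq_mul_inv (-δ)]
  ring

lemma lintegral_normFactor_mul_nearSum_le {t : ℝ} (ht : 0 < t) (z : Waveguide n m) :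
    ENNReal.ofReal (normFactor n m t) * ∫⁻ w,
      ENNReal.ofReal (Real.exp (-dist w (lift 0 z) ^ 2 / (4 * t))) ∂(coverMeasure volume) ≤ 1 := by
  have h1 := lintegral_nearSum_mul volume (measurable_const (a := (1 : ℝ≥0∞))) t z
  simp only [mul_one, one_mul] at h1
  rw [← h1, ← lintegral_const_mul' _ _ ENNReal.ofReal_ne_top, ← lintegral_eKernel_sub ht z]
  exact lintegral_mono fun z' => normFactor_mul_nearSum_le t z z'

/-- Gaussian averages of a function whose averages over small balls tend to zero. -/
lemma tendsto_lintegral_eKernel_mul {H : Waveguide n m → ℝ≥0∞} (hH : Measurable H)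
    (z : Waveguide n m) {T : ℝ} (hT : 0 < T) (hfin : ∫⁻ z', eKernel T (z - z') * H z' < ∞)
    (havg : Tendsto (fun r => (∫⁻ w in Metric.closedBall (lift 0 z) r, H (proj w)
      ∂(coverMeasure volume)) / coverMeasure volume (Metric.closedBall (lift 0 z) r))
      (𝓝[>] 0) (𝓝 0)) :
    Tendsto (fun t => ∫⁻ z', eKernel t (z - z') * H z') (𝓝[>] 0) (𝓝 0) := by
  set μ := coverMeasure (volume : Measure (Waveguide n m)) with hμ
  set w₀ := lift 0 z with hw₀
  set A := thetaConst T ^ n with hA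
  have hAtop : A ≠ ∞ := (ENNReal.pow_lt_top (thetaConst_lt_top hT)).ne
  have hHm : Measurable fun w : Cover n m => H (proj w) := hH.comp measurable_proj
  -- The finite Gaussian average at the fixed time `T` will control the far field at all smaller
  -- times.
  set J := ∫⁻ w, H (proj w) * ENNReal.ofReal (Real.exp (-dist w w₀ ^ 2 / (4 * T))) ∂μ with hJ
  have hJfin : J ≠ ∞ := by
    have hc : ENNReal.ofReal (normFactor n m T) ≠ 0 := by simpa using normFactor_pos hT
    have h1 : ENNReal.ofReal (normFactor n m T) * J < ∞ := by
      refine lt_of_le_of_lt ?_ hfin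
      rw [hJ, ← lintegral_nearSum_mul volume hH, ← lintegral_const_mul' _ _ ENNReal.ofReal_ne_top]
      refine lintegral_mono fun z' => ?_
      rw [← mul_assoc]
      exact mul_le_mul' (normFactor_mul_nearSum_le T z z') le_rfl
    exact fun h => by rw [h, ENNReal.mul_top hc] at h1; exact lt_irrefl _ h1
  rw [ENNReal.tendsto_nhds_zero]
  intro ε hε
  have hε2 : ε / 2 ≠ 0 := (ENNReal.half_pos hε.ne').ne'
  -- The tolerance `ε / 2 / A` anticipates the factor `A` lost in passing from the kernel to
  -- `nearSum`.
  obtain ⟨δ, hδ, hδavg⟩ : ∃ δ > 0, ∀ r, 0 < r → r ≤ δ →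
      ∫⁻ w in Metric.closedBall w₀ r, H (proj w) ∂μ ≤
        ε / 2 / A * μ (Metric.closedBall w₀ r) := by
    have h1 := (ENNReal.tendsto_nhds_zero.1 havg) (ε / 2 / A) (ENNReal.div_pos hε2 hAtop)
    obtain ⟨δ, hδ, h2⟩ := mem_nhdsGT_iff_exists_Ioc_subset.1 h1
    refine ⟨δ, hδ, fun r hr hrδ => ?_⟩
    by_cases h0 : μ (Metric.closedBall w₀ r) = 0
    · rw [Measure.restrict_eq_zero.2 h0]; simp
    · exact (ENNReal.div_le_iff_le_mul (Or.inl h0)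
        (Or.inl (finiteOnSlabs_volume.coverMeasure_closedBall_lt_top _ _).ne)).1 (h2 ⟨hr, hrδ⟩)
  set B := Metric.closedBall w₀ δ with hB
  have hBm : MeasurableSet B := Metric.isClosed_closedBall.measurableSet
  have hnear : ∀ t, 0 < t → ENNReal.ofReal (normFactor n m t) *
      ∫⁻ w, B.indicator (fun w => H (proj w)) w *
        ENNReal.ofReal (Real.exp (-dist w w₀ ^ 2 / (4 * t))) ∂μ ≤ ε / 2 / A := by
    intro t ht
    have h1 := CenteredMaximal.lintegral_mul_exp_le_of_forall (μ := μ) (hHm.indicator hBm) w₀ ht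
      (M := ε / 2 / A) (fun r hr => ?_)
    · calc _ ≤ ENNReal.ofReal (normFactor n m t) * (ε / 2 / A *
            ∫⁻ w, ENNReal.ofReal (Real.exp (-dist w w₀ ^ 2 / (4 * t))) ∂μ) := by gcongr
        _ = ε / 2 / A * (ENNReal.ofReal (normFactor n m t) *
            ∫⁻ w, ENNReal.ofReal (Real.exp (-dist w w₀ ^ 2 / (4 * t))) ∂μ) := by ring
        _ ≤ ε / 2 / A * 1 := by
            gcongr; exact lintegral_normFactor_mul_nearSum_le ht z
        _ = _ := mul_one _
    · rw [setLIntegral_indicator hBm]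
      -- After truncation to `B`, radii beyond `δ` see nothing new, so the small average bound holds
      -- at every radius.
      have hmin : B ∩ Metric.closedBall w₀ r = Metric.closedBall w₀ (min r δ) := by
        ext w; simp [hB, and_comm]
      rw [hmin]
      refine (hδavg _ (lt_min hr hδ) (min_le_right _ _)).trans ?_
      gcongr
      exact min_le_left _ _
  -- Outside `B` the exponent `d²/(4t)` is split in half: one half exceeds `δ²/(8t)`, the other
  -- exceeds `d²/(4T)` since `t ≤ T/2`.
  have hfar : ∀ t, 0 < t → t ≤ T / 2 → ENNReal.ofReal (normFactor n m t) *
      ∫⁻ w, Bᶜ.indicator (fun w => H (proj w)) w *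
        ENNReal.ofReal (Real.exp (-dist w w₀ ^ 2 / (4 * t))) ∂μ ≤
      ENNReal.ofReal (normFactor n m t * Real.exp (-(δ ^ 2 / 8) / t)) * J := by
    intro t ht htT
    rw [ENNReal.ofReal_mul (normFactor_pos ht).le, mul_assoc, hJ,
      ← lintegral_const_mul' (ENNReal.ofReal (Real.exp _)) _ ENNReal.ofReal_ne_top]
    refine mul_le_mul' le_rfl (lintegral_mono fun w => ?_)
    by_cases hw : w ∈ B
    · simp [hw]
    · rw [indicator_of_mem (show w ∈ Bᶜ from hw), mul_left_comm,
        ← ENNReal.ofReal_mul (Real.exp_pos _).le, ← Real.exp_add]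
      refine mul_le_mul' le_rfl (ENNReal.ofReal_le_ofReal (Real.exp_le_exp.2 ?_))
      have hd : δ < dist w w₀ := by simpa [hB] using hw
      have h1 : δ ^ 2 / (8 * t) ≤ dist w w₀ ^ 2 / (8 * t) := by gcongr
      have h2 : dist w w₀ ^ 2 / (4 * T) ≤ dist w w₀ ^ 2 / (8 * t) := by
        exact div_le_div_of_nonneg_left (sq_nonneg _) (by positivity) (by linarith)
      have h3 : -dist w w₀ ^ 2 / (4 * t) = -(dist w w₀ ^ 2 / (8 * t)) - dist w w₀ ^ 2 / (8 * t) := by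
        field_simp; ring
      have h4 : -(δ ^ 2 / 8) / t = -(δ ^ 2 / (8 * t)) := by field_simp
      rw [h3, h4, neg_div]
      linarith
  have hη : ∀ᶠ t in 𝓝[>] (0 : ℝ),
      ENNReal.ofReal (normFactor n m t * Real.exp (-(δ ^ 2 / 8) / t)) * (A * J) ≤ ε / 2 := by
    have h1 := ENNReal.Tendsto.mul_const (b := A * J)
      (tendsto_normFactor_mul_exp n m (by positivity : 0 < δ ^ 2 / 8))
      (Or.inr (ENNReal.mul_ne_top hAtop hJfin))
    rw [zero_mul] at h1
    exact (ENNReal.tendsto_nhds_zero.1 h1) _ (pos_iff_ne_zero.2 hε2)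
  filter_upwards [hη, Ioc_mem_nhdsGT (by positivity : 0 < T / 2)] with t hηt ⟨ht0, htT⟩
  have hsplit : ∫⁻ w, H (proj w) * ENNReal.ofReal (Real.exp (-dist w w₀ ^ 2 / (4 * t))) ∂μ =
      (∫⁻ w, B.indicator (fun w => H (proj w)) w *
        ENNReal.ofReal (Real.exp (-dist w w₀ ^ 2 / (4 * t))) ∂μ) +
      ∫⁻ w, Bᶜ.indicator (fun w => H (proj w)) w *
        ENNReal.ofReal (Real.exp (-dist w w₀ ^ 2 / (4 * t))) ∂μ := by
    rw [← lintegral_add_left (f := fun w => B.indicator (fun w => H (proj w)) w *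
      ENNReal.ofReal (Real.exp (-dist w w₀ ^ 2 / (4 * t))))
      ((hHm.indicator hBm).mul (measurable_exp_dist t w₀))]
    refine lintegral_congr fun w => ?_
    by_cases hw : w ∈ B <;> simp [hw]
  calc ∫⁻ z', eKernel t (z - z') * H z'
      ≤ ∫⁻ z', (A * ENNReal.ofReal (normFactor n m t)) * (nearSum t z z' * H z') := by
        refine lintegral_mono fun z' => ?_
        calc _ ≤ A * (ENNReal.ofReal (normFactor n m t) * nearSum t z z') * H z' :=
              mul_le_mul' (eKernel_sub_le ht0 (by linarith) z z') le_rfl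
          _ = _ := by ring
    _ = A * (ENNReal.ofReal (normFactor n m t) * ∫⁻ w, H (proj w) *
          ENNReal.ofReal (Real.exp (-dist w w₀ ^ 2 / (4 * t))) ∂μ) := by
        rw [lintegral_const_mul' _ _ (ENNReal.mul_ne_top hAtop ENNReal.ofReal_ne_top),
          lintegral_nearSum_mul volume hH, mul_assoc]
    _ ≤ A * (ε / 2 / A + ENNReal.ofReal (normFactor n m t * Real.exp (-(δ ^ 2 / 8) / t)) * J) := by
        rw [hsplit, mul_add]
        exact mul_le_mul' le_rfl (add_le_add (hnear t ht0) (hfar t ht0 htT))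
    _ = A * (ε / 2 / A) +
          ENNReal.ofReal (normFactor n m t * Real.exp (-(δ ^ 2 / 8) / t)) * (A * J) := by ring
    _ ≤ ε / 2 + ε / 2 := add_le_add ENNReal.mul_div_le hηt
    _ = ε := ENNReal.add_halves ε

lemma integral_heatKernel_sub {t : ℝ} (ht : 0 < t) (z : Waveguide n m) :
    ∫ z' : Waveguide n m, heatKernel t (z - z') = 1 := by
  have hm : Measurable fun z' : Waveguide n m => heatKernel t (z - z') :=
    (measurable_heatKernel ht).comp (measurable_id.const_sub z)
  rw [integral_eq_lintegral_of_nonneg_ae (Eventually.of_forall fun z' => heatKernel_nonneg ht _)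
    hm.aestronglyMeasurable]
  simp_rw [ofReal_heatKernel ht]
  rw [lintegral_eKernel_sub ht, ENNReal.toReal_one]

lemma integrable_heatKernel_sub {t : ℝ} (ht : 0 < t) (z : Waveguide n m) :
    Integrable (fun z' : Waveguide n m => (heatKernel t (z - z') : ℂ)) := by
  have h1 : Integrable (fun z' : Waveguide n m => heatKernel t (z - z')) := by
    by_contra h
    have := integral_heatKernel_sub ht z
    rw [integral_undef h] at this
    exact zero_ne_one this
  exact h1.ofReal

/-- The kernel has mass one, so `f z` is its own heat average. -/
lemma edist_heatConv_le {t : ℝ} (ht : 0 < t) {f : Waveguide n m → ℂ} {z : Waveguide n m}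
    (hconv : HeatConvFinite t f z) :
    edist (heatConv t f z) (f z) ≤ ∫⁻ z', eKernel t (z - z') * ‖f z' - f z‖ₑ := by
  have h1 : f z = ∫ z', (heatKernel t (z - z') : ℂ) * f z := by
    rw [integral_mul_const, integral_complex_ofReal, integral_heatKernel_sub ht]
    simp
  rw [edist_eq_enorm_sub]
  conv_lhs => rw [h1]
  rw [heatConv, ← integral_sub hconv ((integrable_heatKernel_sub ht z).mul_const _)]
  refine (enorm_integral_le_lintegral_enorm _).trans (le_of_eq (lintegral_congr fun z' => ?_))
  rw [← mul_sub, enorm_mul, enorm_heatKernel ht]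

/-- At almost every `z` the averages of `|f - f z|` over small balls vanish and the majorant is
finite. The latter bounds the Gaussian average of `|f - f z|` at the fixed time `timeBound a`. -/
lemma ae_tendsto_heatConv {f : Waveguide n m → ℂ} (hf : Measurable f) {a : ℝ} (ha : 0 < a)
    (hfin : ∫⁻ z, ‖f z‖ₑ * growth (-a) z < ∞) :
    ∀ᵐ z, Tendsto (fun t : ℝ => heatConv t f z) (𝓝[>] 0) (𝓝 (f z)) := by
  filter_upwards [ae_tendsto_average hf ha hfin, ae_majorant_lt_top ha hf.enorm hfin.ne]
    with z hz hmaj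
  have hT := timeBound_pos ha
  have hconv : ∀ t, 0 < t → t ≤ timeBound a → ∫⁻ z', eKernel t (z - z') * ‖f z'‖ₑ < ∞ :=
    fun t ht htT => (lintegral_eKernel_mul_le_majorant ha ht
      (mul_le_one_of_le_timeBound ha htT) hf.enorm z).trans_lt hmaj
  have hH : Measurable fun z' => ‖f z' - f z‖ₑ := (hf.sub_const _).enorm
  have hHfin : ∫⁻ z', eKernel (timeBound a) (z - z') * ‖f z' - f z‖ₑ < ∞ := by
    calc _ ≤ ∫⁻ z', (eKernel (timeBound a) (z - z') * ‖f z'‖ₑ +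
          eKernel (timeBound a) (z - z') * ‖f z‖ₑ) := by
          refine lintegral_mono fun z' => ?_
          rw [← mul_add]
          exact mul_le_mul' le_rfl enorm_sub_le
      _ = (∫⁻ z', eKernel (timeBound a) (z - z') * ‖f z'‖ₑ) + ‖f z‖ₑ := by
          rw [lintegral_add_left (f := fun z' => eKernel (timeBound a) (z - z') * ‖f z'‖ₑ)
              ((measurable_eKernel_sub _ z).mul hf.enorm),
            lintegral_mul_const _ (measurable_eKernel_sub _ z), lintegral_eKernel_sub hT, one_mul]
      _ < ∞ := ENNReal.add_lt_top.2 ⟨hconv _ hT le_rfl, enorm_lt_top⟩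
  rw [tendsto_iff_edist_tendsto_0]
  refine tendsto_of_tendsto_of_tendsto_of_le_of_le' tendsto_const_nhds
    (tendsto_lintegral_eKernel_mul hH z hT hHfin hz) (Eventually.of_forall fun _ => zero_le) ?_
  filter_upwards [Ioc_mem_nhdsGT hT] with t ht
  exact edist_heatConv_le ht.1
    ((heatConvFinite_iff ht.1 hf.aestronglyMeasurable z).2 (hconv t ht.1 ht.2))

theorem MemDWG.ae_tendsto_heatConv {p : ℝ} (hp : 1 ≤ p) {v : Waveguide n m → ℝ} (hv : IsWeight v)
    (h : MemDWG p v) : ∃ R : ℝ, 0 < R ∧ R < 1 / 2 ∧ ∀ f : Waveguide n m → ℂ, MemWLp p v f →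
      (∀ᵐ z, HeatConvFinite R f z) ∧
        ∀ᵐ z, Tendsto (fun t : ℝ => heatConv t f z) (𝓝[>] 0) (𝓝 (f z)) := by
  obtain ⟨a, ha, C, hC⟩ := h.exists_lintegral_le hp hv
  refine ⟨timeBound a, timeBound_pos ha, timeBound_lt_half a, fun f hf => ?_⟩
  -- A measurable representative is needed for the composition with `proj`; convolutions do not see
  -- the change.
  set f₀ := hf.1.mk f with hf₀
  have hf₀m : Measurable f₀ := hf.1.stronglyMeasurable_mk.measurable
  have hae : ∀ᵐ z, f z = f₀ z := hf.1.ae_eq_mk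
  have hF : ∀ᵐ z, ‖f z‖ₑ = ‖f₀ z‖ₑ := by
    filter_upwards [hae] with z hz
    rw [hz]
  have h1 := hC _ hf₀m.enorm
  rw [lintegral_rpow_mul_eq_wLpNorm hp hv hF] at h1
  have hfin := h1.trans_lt (ENNReal.mul_lt_top ENNReal.coe_lt_top hf.2)
  constructor
  · filter_upwards [ae_majorant_lt_top ha hf₀m.enorm hfin.ne] with z hz
    rw [heatConvFinite_iff (timeBound_pos ha) hf.1]
    refine lt_of_le_of_lt (le_of_eq (lintegral_congr_ae ?_)) ((lintegral_eKernel_mul_le_majorant ha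
      (timeBound_pos ha) (mul_le_one_of_le_timeBound ha le_rfl) hf₀m.enorm z).trans_lt hz)
    filter_upwards [hF] with z' hz'
    rw [hz']
  · have hconv : ∀ t z, heatConv t f z = heatConv t f₀ z := by
      intro t z
      refine integral_congr_ae ?_
      filter_upwards [hae] with z' hz'
      rw [hz']
    filter_upwards [Waveguide.ae_tendsto_heatConv hf₀m ha hfin, hae] with z hz hz'
    simp_rw [hconv, hz']
    exact hz

end Waveguide

/-! ### The converse of Hölder's inequality. -/

section ConverseHolder

variable {α : Type*} [MeasurableSpace α] {μ : Measure α} {g : α → ℝ≥0∞} {p : ℝ}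

/-- If `g h` is integrable for every `h ∈ L^p`, then `h ↦ ∫ g h` is bounded on `L^p`. -/
lemma exists_lintegral_mul_le_of_forall_lt_top (hp : 1 ≤ p)
    (H : ∀ h : α → ℝ≥0∞, Measurable h → ∫⁻ x, h x ^ p ∂μ < ∞ → ∫⁻ x, g x * h x ∂μ < ∞) :
    ∃ C : ℝ≥0, ∀ h : α → ℝ≥0∞, Measurable h → ∫⁻ x, h x ^ p ∂μ ≤ 1 → ∫⁻ x, g x * h x ∂μ ≤ C := by
  have hp0 : 0 < p := by linarith
  by_contra! hcon
  choose h hm hle hlt using fun k : ℕ => hcon ((4 : ℝ≥0) ^ k)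
  -- Gliding hump: the pairings exceed `4^k`, so with factors `2^{-k}` they still exceed `2^k`.
  -- Combining the `c k * h k` as an `ℓ^p` sum keeps the `p`-th power integrable without Minkowski's
  -- inequality, and its root dominates each summand.
  set c : ℕ → ℝ≥0∞ := fun k => 2⁻¹ ^ k with hc
  have hc1 : ∀ k, c k ≤ 1 := fun k => pow_le_one' (ENNReal.inv_le_one.2 one_le_two) k
  set F : α → ℝ≥0∞ := fun x => ∑' k, (c k * h k x) ^ p with hF
  have hterm : ∀ k, Measurable fun x => (c k * h k x) ^ p := fun k =>
    ((hm k).const_mul _).pow_const p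
  have hFm : Measurable F := Measurable.tsum hterm
  have hFint : ∫⁻ x, F x ∂μ < ∞ := by
    rw [hF, lintegral_tsum fun k => (hterm k).aemeasurable]
    calc ∑' k, ∫⁻ x, (c k * h k x) ^ p ∂μ ≤ ∑' k, 2⁻¹ ^ k := by
          refine ENNReal.tsum_le_tsum fun k => ?_
          simp_rw [ENNReal.mul_rpow_of_nonneg _ _ hp0.le]
          rw [lintegral_const_mul _ ((hm k).pow_const p)]
          calc c k ^ p * ∫⁻ x, h k x ^ p ∂μ ≤ c k ^ (1 : ℝ) * 1 :=
                mul_le_mul' (ENNReal.rpow_le_rpow_of_exponent_ge (hc1 k) hp) (hle k)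
            _ = _ := by simp [hc]
      _ = 2 := by rw [ENNReal.tsum_geometric, ENNReal.one_sub_inv_two, inv_inv]
      _ < ∞ := by simp
  have hfin := H (fun x => F x ^ (1 / p)) (hFm.pow_const _) (by
    simpa [← ENNReal.rpow_mul, hp0.ne'] using hFint)
  have hbig : ∀ k : ℕ, (2 : ℝ≥0∞) ^ k ≤ ∫⁻ x, g x * F x ^ (1 / p) ∂μ := by
    intro k
    have hle' : ∀ x, c k * h k x ≤ F x ^ (1 / p) := fun x => by
      have h1 : (c k * h k x) ^ p ≤ F x := ENNReal.le_tsum k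
      calc c k * h k x = ((c k * h k x) ^ p) ^ (1 / p) := by
            rw [← ENNReal.rpow_mul, mul_one_div_cancel hp0.ne', ENNReal.rpow_one]
        _ ≤ _ := ENNReal.rpow_le_rpow h1 (by positivity)
    calc (2 : ℝ≥0∞) ^ k = c k * 4 ^ k := by
          rw [hc, ← mul_pow]
          congr 1
          rw [show (4 : ℝ≥0∞) = 2 * 2 by norm_num, ← mul_assoc,
            ENNReal.inv_mul_cancel (by simp) (by simp), one_mul]
      _ ≤ c k * ∫⁻ x, g x * h k x ∂μ := by
          gcongr
          exact_mod_cast (hlt k).le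
      _ = ∫⁻ x, c k * (g x * h k x) ∂μ := by
          rw [lintegral_const_mul' _ _ ((hc1 k).trans_lt ENNReal.one_lt_top).ne]
      _ ≤ _ := by
          refine lintegral_mono fun x => ?_
          rw [mul_left_comm]
          exact mul_le_mul' le_rfl (hle' x)
  obtain ⟨k, hk⟩ := ENNReal.exists_nat_gt hfin.ne
  have h2 : (k : ℝ≥0∞) ≤ 2 ^ k := by exact_mod_cast (Nat.lt_two_pow_self (n := k)).le
  exact absurd (h2.trans (hbig k)) (not_le.2 hk)

/-- Test against normalized indicators of sets of finite measure. -/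
lemma ae_le_of_forall_lintegral_mul_le [SigmaFinite μ] (hg : Measurable g) {C : ℝ≥0}
    (H : ∀ h : α → ℝ≥0∞, Measurable h → ∫⁻ x, h x ∂μ ≤ 1 → ∫⁻ x, g x * h x ∂μ ≤ C) :
    ∀ᵐ x ∂μ, g x ≤ C := by
  refine ae_le_of_forall_setLIntegral_le_of_sigmaFinite hg fun s hs hμs => ?_
  rw [setLIntegral_const]
  by_cases h0 : μ s = 0
  · rw [Measure.restrict_eq_zero.2 h0]; simp
  have h1 := H (s.indicator fun _ => (μ s)⁻¹) (measurable_const.indicator hs) (by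
    rw [lintegral_indicator hs, setLIntegral_const, ENNReal.inv_mul_cancel h0 hμs.ne])
  have h2 : ∀ x, g x * s.indicator (fun _ => (μ s)⁻¹) x = (μ s)⁻¹ * s.indicator g x := by
    intro x
    by_cases hx : x ∈ s <;> simp [hx, mul_comm]
  simp_rw [h2] at h1
  rw [lintegral_const_mul _ (hg.indicator hs), lintegral_indicator hs] at h1
  calc ∫⁻ x in s, g x ∂μ = (μ s) * ((μ s)⁻¹ * ∫⁻ x in s, g x ∂μ) := by
        rw [← mul_assoc, ENNReal.mul_inv_cancel h0 hμs.ne, one_mul]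
    _ ≤ μ s * C := by gcongr
    _ = C * μ s := mul_comm _ _

/-- Test against the extremal function `g^{q-1}`, truncated to sets of finite measure on which `g`
is bounded, so that the quantity `I` to be divided by is finite. -/
lemma lintegral_rpow_lt_top_of_forall_lintegral_mul_le [SigmaFinite μ] (hg : Measurable g)
    (hgtop : ∀ x, g x ≠ ∞) {q : ℝ} (hpq : p.HolderConjugate q) {C : ℝ≥0}
    (H : ∀ h : α → ℝ≥0∞, Measurable h → ∫⁻ x, h x ^ p ∂μ ≤ 1 → ∫⁻ x, g x * h x ∂μ ≤ C) :
    ∫⁻ x, g x ^ q ∂μ < ∞ := by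
  have hp0 := hpq.pos
  have hq0 := hpq.symm.pos
  set S : ℕ → Set α := fun N => spanningSets μ N ∩ {x | g x ≤ N} with hS
  have hSm : ∀ N, MeasurableSet (S N) := fun N =>
    (measurableSet_spanningSets μ N).inter (measurableSet_le hg measurable_const)
  have hSmono : Monotone S := by
    intro i j hij x hx
    refine ⟨monotone_spanningSets μ hij hx.1, ?_⟩
    have : g x ≤ i := hx.2
    exact this.trans (by exact_mod_cast hij)
  have hSunion : ⋃ N, S N = univ := by
    refine eq_univ_of_forall fun x => ?_
    obtain ⟨N, hN⟩ := ENNReal.exists_nat_gt (hgtop x)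
    have hx : x ∈ spanningSets μ (spanningSetsIndex μ x) := mem_spanningSetsIndex μ x
    refine mem_iUnion.2 ⟨max N (spanningSetsIndex μ x),
      monotone_spanningSets μ (le_max_right _ _) hx, ?_⟩
    have : (N : ℝ≥0∞) ≤ (max N (spanningSetsIndex μ x) : ℕ) := by
      exact_mod_cast le_max_left _ _
    exact hN.le.trans this
  have key : ∀ N, ∫⁻ x in S N, g x ^ q ∂μ ≤ (C : ℝ≥0∞) ^ q := by
    intro N
    set I := ∫⁻ x in S N, g x ^ q ∂μ with hI
    have hIfin : I ≠ ∞ := by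
      refine (lt_of_le_of_lt (setLIntegral_mono' (g := fun _ => (N : ℝ≥0∞) ^ q) (hSm N)
        fun x hx => ENNReal.rpow_le_rpow hx.2 hq0.le) ?_).ne
      rw [setLIntegral_const]
      exact ENNReal.mul_lt_top (ENNReal.rpow_lt_top_of_nonneg hq0.le (by simp))
        ((measure_mono inter_subset_left).trans_lt (measure_spanningSets_lt_top μ N))
    by_cases hI0 : I = 0
    · rw [hI0]; exact zero_le
    have hrp0 : I ^ (1 / p) ≠ 0 := fun h => hI0 (by
      simpa using (ENNReal.rpow_eq_zero_iff_of_pos (by positivity)).1 h)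
    have hrptop : I ^ (1 / p) ≠ ∞ := ENNReal.rpow_ne_top_of_nonneg (by positivity) hIfin
    -- Since `(q - 1) p = q`, this has `L^p` norm one, and its pairing with `g` is `I^{1 - 1/p} =
    -- I^{1/q}`.
    set h : α → ℝ≥0∞ := (S N).indicator fun x => (I ^ (1 / p))⁻¹ * g x ^ (q - 1) with hh
    have hq1 : 0 ≤ q - 1 := by linarith [hpq.symm.lt]
    have hhp : ∀ x, h x ^ p = (S N).indicator (fun x => I⁻¹ * g x ^ q) x := by
      intro x
      by_cases hx : x ∈ S N
      · rw [hh, indicator_of_mem hx, indicator_of_mem hx, ENNReal.mul_rpow_of_nonneg _ _ hp0.le,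
          ENNReal.inv_rpow, ← ENNReal.rpow_mul, ← ENNReal.rpow_mul, one_div,
          inv_mul_cancel₀ hp0.ne', ENNReal.rpow_one, hpq.symm.sub_one_mul_conj]
      · rw [hh, indicator_of_notMem hx, indicator_of_notMem hx, ENNReal.zero_rpow_of_pos hp0]
    have hgh : ∀ x, g x * h x = (S N).indicator (fun x => (I ^ (1 / p))⁻¹ * g x ^ q) x := by
      intro x
      by_cases hx : x ∈ S N
      · rw [hh, indicator_of_mem hx, indicator_of_mem hx, mul_left_comm]
        congr 1
        conv_lhs => rw [← ENNReal.rpow_one (g x), ← ENNReal.rpow_mul, one_mul,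
          ← ENNReal.rpow_add_of_nonneg _ _ zero_le_one hq1]
        congr 1; ring
      · rw [hh, indicator_of_notMem hx, indicator_of_notMem hx, mul_zero]
    have h1 := H h ((((hg.pow_const _).const_mul _)).indicator (hSm N)) (by
      simp_rw [hhp]
      rw [lintegral_indicator (hSm N), lintegral_const_mul _ (hg.pow_const _), ← hI,
        ENNReal.inv_mul_cancel hI0 hIfin])
    simp_rw [hgh] at h1
    rw [lintegral_indicator (hSm N), lintegral_const_mul _ (hg.pow_const _), ← hI] at h1
    have h2 : (I ^ (1 / p))⁻¹ * I = I ^ (1 / q) := by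
      rw [← ENNReal.rpow_neg]
      conv_lhs => rw [← ENNReal.rpow_one I, ← ENNReal.rpow_mul, one_mul]
      rw [← ENNReal.rpow_add _ _ hI0 hIfin]
      congr 1
      have := hpq.inv_add_inv_eq_one
      simp only [one_div]
      linarith
    rw [h2] at h1
    calc I = (I ^ (1 / q)) ^ q := by
          rw [← ENNReal.rpow_mul, one_div, inv_mul_cancel₀ hq0.ne', ENNReal.rpow_one]
      _ ≤ _ := ENNReal.rpow_le_rpow h1 hq0.le
  have hfinal : ∫⁻ x, g x ^ q ∂μ ≤ (C : ℝ≥0∞) ^ q := by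
    -- Monotone convergence, as continuity from below of the measure with density `g^q`.
    have hmeas := hSmono.measure_iUnion (μ := μ.withDensity fun x => g x ^ q)
    rw [hSunion, withDensity_apply _ MeasurableSet.univ, Measure.restrict_univ] at hmeas
    rw [hmeas]
    refine iSup_le fun N => ?_
    rw [withDensity_apply _ (hSm N)]
    exact key N
  exact hfinal.trans_lt (ENNReal.rpow_lt_top_of_nonneg hq0.le ENNReal.coe_ne_top)

end ConverseHolder

/-! ### Necessity of `D_p`. -/

namespace Waveguide

variable {n m : ℕ}

/-- The torus part of the squared distance is at most `n/4` and `|y - y'|² ≤ 2|y|² + 2|y'|²`; the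
`y'` term gives the rate `1/(2t)`, all else goes into `B`, which may depend on `z`. -/
lemma growth_le_of_eKernel {t : ℝ} (ht : 0 < t) (z : Waveguide n m) :
    ∃ B : ℝ≥0∞, B ≠ 0 ∧ B ≠ ∞ ∧ ∀ z', B * growth (-(1 / (2 * t))) z' ≤ eKernel t (z - z') := by
  refine ⟨ENNReal.ofReal (normFactor n m t) *
    ENNReal.ofReal (Real.exp (-(n / 4 + 2 * ‖z.2‖ ^ 2) / (4 * t))), ?_, by finiteness, ?_⟩
  · have := normFactor_pos (n := n) (m := m) ht
    simp [this, Real.exp_pos]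
  · intro z'
    refine le_trans ?_ (le_eKernel t (z - z'))
    rw [mul_assoc]
    refine mul_le_mul' le_rfl ?_
    rw [growth, ← ENNReal.ofReal_mul (Real.exp_pos _).le, ← Real.exp_add]
    refine ENNReal.ofReal_le_ofReal (Real.exp_le_exp.2 ?_)
    have h1 : ∑ i, rep ((z - z').1 i) ^ 2 ≤ n / 4 := by
      calc ∑ i, rep ((z - z').1 i) ^ 2 ≤ ∑ _i : Fin n, (1 / 4 : ℝ) := by
            refine Finset.sum_le_sum fun i _ => ?_
            rw [← sq_abs]
            nlinarith [abs_rep_le ((z - z').1 i), abs_nonneg (rep ((z - z').1 i))]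
        _ = n / 4 := by simp [div_eq_mul_inv]
    have h2 : ‖z.2 - z'.2‖ ^ 2 ≤ 2 * ‖z.2‖ ^ 2 + 2 * ‖z'.2‖ ^ 2 := by
      nlinarith [norm_sub_le z.2 z'.2, norm_nonneg (z.2 - z'.2), sq_nonneg (‖z.2‖ - ‖z'.2‖)]
    have h3 : sqNorm (z - z') ≤ n / 4 + 2 * ‖z.2‖ ^ 2 + 2 * ‖z'.2‖ ^ 2 := by
      rw [sqNorm, Prod.snd_sub]; linarith
    have h4 : -(n / 4 + 2 * ‖z.2‖ ^ 2) / (4 * t) + -(1 / (2 * t)) * ‖z'.2‖ ^ 2 =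
        -(n / 4 + 2 * ‖z.2‖ ^ 2 + 2 * ‖z'.2‖ ^ 2) / (4 * t) := by
      field_simp; ring
    rw [h4]
    gcongr

/-- The weight is in `D_p` as soon as one heat average of each function is finite somewhere. -/
theorem memDWG_of_exists_lintegral_lt_top {p : ℝ} (hp : 1 ≤ p) {v : Waveguide n m → ℝ}
    (hv : IsWeight v) {t : ℝ} (ht : 0 < t)
    (H : ∀ f : Waveguide n m → ℂ, MemWLp p v f →
      ∃ z, ∫⁻ z', eKernel t (z - z') * ‖f z'‖ₑ < ∞) : MemDWG p v := by
  have hp0 : 0 < p := by linarith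
  set b := 1 / (2 * t) with hb
  have hb0 : 0 < b := by positivity
  set g : Waveguide n m → ℝ≥0∞ := fun z => dualWeight p v z * growth (-b) z with hg
  have hgm : Measurable g := (measurable_dualWeight p hv).mul (measurable_growth _)
  have hfin : ∀ h : Waveguide n m → ℝ≥0∞, Measurable h → ∫⁻ z, h z ^ p < ∞ →
      ∫⁻ z, g z * h z < ∞ := by
    intro h hh hhp
    -- Multiplication by `v^{-1/p}` carries `L^p` isometrically into `L^p_v`; `toReal` is harmless
    -- because `h` is finite almost everywhere.
    set f : Waveguide n m → ℂ := fun z => (((h z).toReal * v z ^ (-(1 / p)) : ℝ) : ℂ) with hf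
    have hfm : Measurable f :=
      Complex.measurable_ofReal.comp (hh.ennreal_toReal.mul (hv.measurable.pow_const _))
    have htop : ∀ᵐ z, h z < ∞ := by
      filter_upwards [ae_lt_top (hh.pow_const p) hhp.ne] with z hz
      exact (ENNReal.rpow_lt_top_iff_of_pos hp0).1 hz
    have hfn : ∀ᵐ z, ‖f z‖ₑ = h z * dualWeight p v z := by
      filter_upwards [htop] with z hz
      rw [hf, ← ofReal_norm, Complex.norm_real, Real.norm_of_nonneg
        (mul_nonneg ENNReal.toReal_nonneg (Real.rpow_nonneg (hv.pos z).le _)),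
        ENNReal.ofReal_mul ENNReal.toReal_nonneg, ENNReal.ofReal_toReal hz.ne, dualWeight]
    have hmem : MemWLp p v f := by
      refine ⟨hfm.aestronglyMeasurable, ?_⟩
      rw [← lintegral_rpow_mul_eq_wLpNorm hp hv hfn]
      refine ENNReal.rpow_lt_top_of_nonneg (by positivity)
        (lt_of_le_of_lt (le_of_eq (lintegral_congr fun z => ?_)) hhp).ne
      rw [ENNReal.mul_rpow_of_nonneg _ _ hp0.le, mul_assoc, ← ofReal_rpow_one_div_rpow hp0 (hv.pos z),
        ← ENNReal.mul_rpow_of_nonneg _ _ hp0.le, dualWeight_mul_rpow p hv, ENNReal.one_rpow, mul_one]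
    obtain ⟨z, hz⟩ := H f hmem
    obtain ⟨B, hB0, hBtop, hB⟩ := growth_le_of_eKernel ht z
    have h1 : B * ∫⁻ z', g z' * h z' < ∞ := by
      rw [← lintegral_const_mul' _ _ hBtop]
      refine lt_of_le_of_lt (lintegral_mono_ae ?_) hz
      filter_upwards [hfn] with z' hz'
      rw [hz', hg]
      calc _ = B * growth (-b) z' * (h z' * dualWeight p v z') := by ring
        _ ≤ _ := mul_le_mul' (hB z') le_rfl
    refine lt_top_iff_ne_top.2 fun h2 => ?_
    rw [h2, ENNReal.mul_top hB0] at h1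
    exact lt_irrefl _ h1
  obtain ⟨C, hC⟩ := exists_lintegral_mul_le_of_forall_lt_top hp hfin
  refine (memDWG_iff hp hv).2 ⟨b, hb0, ?_, ?_⟩
  · rintro rfl
    simp only [ENNReal.rpow_one] at hC
    exact ⟨C, ae_le_of_forall_lintegral_mul_le hgm hC⟩
  · intro hp1
    exact lintegral_rpow_lt_top_of_forall_lintegral_mul_le hgm
      (fun z => ENNReal.mul_ne_top ENNReal.ofReal_ne_top (growth_ne_top _ z))
      (Real.HolderConjugate.conjExponent hp1) hC

lemma measurable_lintegral_eKernel {F : Waveguide n m → ℝ≥0∞} (hF : Measurable F) (t : ℝ) :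
    Measurable fun z => ∫⁻ z', eKernel t (z - z') * F z' :=
  Measurable.lintegral_prod_right' (f := fun q : Waveguide n m × Waveguide n m =>
      eKernel t (q.1 - q.2) * F q.2)
    (((measurable_eKernel t).comp (measurable_fst.sub measurable_snd)).mul
      (hF.comp measurable_snd))

lemma measurableSet_lintegral_eKernel_eq_top {f : Waveguide n m → ℂ}
    (hf : AEStronglyMeasurable f volume) (t : ℝ) :
    MeasurableSet {z | ∫⁻ z', eKernel t (z - z') * ‖f z'‖ₑ = ∞} := by
  obtain ⟨F, hFm, hF⟩ := exists_measurable_enorm hf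
  have h1 : ∀ z, ∫⁻ z', eKernel t (z - z') * ‖f z'‖ₑ = ∫⁻ z', eKernel t (z - z') * F z' := by
    intro z
    refine lintegral_congr_ae ?_
    filter_upwards [hF] with z' hz'
    rw [hz']
  simp_rw [h1]
  exact measurable_lintegral_eKernel hFm t (measurableSet_singleton ∞)

lemma exists_lt_top_of_measure_eq_zero {G : Waveguide n m → ℝ≥0∞}
    (h : volume {z | G z = ∞} = 0) : ∃ z, G z < ∞ := by
  have h1 : ∀ᵐ z, G z < ∞ := by
    rw [ae_iff]
    simpa using h
  exact h1.exists

lemma volume_eq_zero_of_setLIntegral_weight {u : Waveguide n m → ℝ} (hu : IsWeight u)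
    {S : Set (Waveguide n m)} (hS : MeasurableSet S)
    (h : ∫⁻ z in S, ENNReal.ofReal (u z) = 0) : volume S = 0 := by
  rw [setLIntegral_eq_zero_iff hS hu.measurable.ennreal_ofReal] at h
  rw [measure_eq_zero_iff_ae_notMem]
  filter_upwards [h] with z hz hzS
  have := hz hzS
  simp only [ENNReal.ofReal_eq_zero] at this
  exact absurd (hu.pos z) (not_lt.2 this)

/-- The maximal operator is infinite on this set, so a finite `L^p_u` norm forces it to be `u`-null,
hence Lebesgue null as `u > 0`. -/
lemma MaximalStrongType.volume_eq_zero {p R t : ℝ} (hp : 1 < p) {v u : Waveguide n m → ℝ}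
    (hu : IsWeight u) (h : MaximalStrongType p R v u) (ht : 0 < t) (htR : t < R)
    {f : Waveguide n m → ℂ} (hf : MemWLp p v f) :
    volume {z | ∫⁻ z', eKernel t (z - z') * ‖f z'‖ₑ = ∞} = 0 := by
  have hp0 : 0 < p := by linarith
  obtain ⟨C, hC⟩ := h
  have h1 := (hC f hf).trans_lt (ENNReal.mul_lt_top ENNReal.coe_lt_top hf.2)
  rw [wLpNorm_eq hp.le hu, ENNReal.rpow_lt_top_iff_of_pos (by positivity)] at h1
  set S := {z | ∫⁻ z', eKernel t (z - z') * ‖f z'‖ₑ = ∞} with hS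
  have hSm : MeasurableSet S := measurableSet_lintegral_eKernel_eq_top hf.1 t
  refine volume_eq_zero_of_setLIntegral_weight hu hSm ?_
  by_contra h0
  have h2 : ∞ * ∫⁻ z in S, ENNReal.ofReal (u z) ≤
      ∫⁻ z, heatMaximal R f z ^ p * ENNReal.ofReal (u z) := by
    rw [← lintegral_const_mul _ hu.measurable.ennreal_ofReal]
    refine (setLIntegral_mono' hSm fun z hz => ?_).trans (setLIntegral_le_lintegral S _)
    rw [heatMaximal_eq_top ht htR hf.1 hz, ENNReal.top_rpow_of_pos hp0]
  rw [ENNReal.top_mul h0] at h2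
  exact absurd h1 (not_lt.2 h2)

/-- The set lies in every superlevel set; letting the height `k` tend to infinity kills its
`u`-measure. -/
lemma MaximalWeakType.volume_eq_zero {R t : ℝ} {v u : Waveguide n m → ℝ}
    (hu : IsWeight u) (h : MaximalWeakType R v u) (ht : 0 < t) (htR : t < R)
    {f : Waveguide n m → ℂ} (hf : MemWLp 1 v f) :
    volume {z | ∫⁻ z', eKernel t (z - z') * ‖f z'‖ₑ = ∞} = 0 := by
  obtain ⟨C, hC⟩ := h
  set S := {z | ∫⁻ z', eKernel t (z - z') * ‖f z'‖ₑ = ∞} with hS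
  have hSm : MeasurableSet S := measurableSet_lintegral_eKernel_eq_top hf.1 t
  refine volume_eq_zero_of_setLIntegral_weight hu hSm ?_
  set N := wLpNorm 1 v fun z => ‖f z‖ₑ with hN
  have h1 : ∀ k : ℕ, k * ∫⁻ z in S, ENNReal.ofReal (u z) ≤ C * N := by
    intro k
    rcases Nat.eq_zero_or_pos k with rfl | hk
    · simp
    have hk0 : (k : ℝ≥0∞) ≠ 0 := by simp; omega
    have h2 : ∫⁻ z in S, ENNReal.ofReal (u z) ≤ C / ENNReal.ofReal k * N := by
      refine le_trans (lintegral_mono_set fun z hz => ?_) (hC f hf k (by exact_mod_cast hk))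
      have : heatMaximal R f z = ∞ := heatMaximal_eq_top ht htR hf.1 hz
      show ENNReal.ofReal k < heatMaximal R f z
      rw [this]; exact ENNReal.ofReal_lt_top
    rw [ENNReal.ofReal_natCast] at h2
    calc k * ∫⁻ z in S, ENNReal.ofReal (u z) ≤ k * (C / k * N) := by gcongr
      _ = C * N := by
          rw [← mul_assoc, ENNReal.mul_div_cancel hk0 (by simp)]
  by_contra h0
  obtain ⟨k, hk⟩ := ENNReal.exists_nat_mul_gt h0 (ENNReal.mul_lt_top ENNReal.coe_lt_top hf.2).ne
  exact absurd (h1 k) (not_le.2 hk)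

end Waveguide

end

theorem theorem4p5 (n m : ℕ) (p : ℝ) (hp : 1 ≤ p)
    (v : Waveguide n m → ℝ) (hv : Waveguide.IsWeight v) :
    List.TFAE [
      Waveguide.MemDWG p v,
      ∃ R : ℝ, 0 < R ∧ R < 1 / 2 ∧ ∃ u : Waveguide n m → ℝ, Waveguide.IsWeight u ∧
        (1 < p → Waveguide.MaximalStrongType p R v u) ∧
        (p = 1 → Waveguide.MaximalWeakType R v u),
      ∃ R : ℝ, 0 < R ∧ R < 1 / 2 ∧ ∀ f : Waveguide n m → ℂ, Waveguide.MemWLp p v f →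
        (∀ᵐ z, Waveguide.HeatConvFinite R f z) ∧
        (∀ᵐ z, Tendsto (fun t : ℝ => Waveguide.heatConv t f z) (𝓝[>] 0) (𝓝 (f z))),
      ∃ R : ℝ, 0 < R ∧ R < 1 / 2 ∧ ∀ f : Waveguide n m → ℂ, Waveguide.MemWLp p v f →
        ∀ᵐ z, Waveguide.heatMaximal R f z < ∞] := by
  tfae_have 1 → 2 := by
    intro h
    rcases hp.eq_or_lt with rfl | hp1
    · obtain ⟨R, hR0, hR, u, hu, hw⟩ := h.exists_maximalWeakType hv
      exact ⟨R, hR0, hR, u, hu, fun h1 => absurd h1 (lt_irrefl _), fun _ => hw⟩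
    · obtain ⟨R, hR0, hR, u, hu, hs⟩ := h.exists_maximalStrongType hp1 hv
      exact ⟨R, hR0, hR, u, hu, fun _ => hs, fun h1 => absurd h1 hp1.ne'⟩
  tfae_have 1 → 3 := fun h => h.ae_tendsto_heatConv hp hv
  tfae_have 1 → 4 := fun h => h.ae_heatMaximal_lt_top hp hv
  tfae_have 2 → 1 := by
    rintro ⟨R, hR0, -, u, hu, hs, hw⟩
    -- The supremum runs over the open interval `(0, R)`, so an interior time such as `R / 2` is
    -- used.
    refine Waveguide.memDWG_of_exists_lintegral_lt_top hp hv (half_pos hR0) fun f hf => ?_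
    refine Waveguide.exists_lt_top_of_measure_eq_zero ?_
    rcases hp.eq_or_lt with rfl | hp1
    · exact (hw rfl).volume_eq_zero hu (half_pos hR0) (half_lt_self hR0) hf
    · exact (hs hp1).volume_eq_zero hp1 hu (half_pos hR0) (half_lt_self hR0) hf
  tfae_have 3 → 1 := by
    rintro ⟨R, hR0, -, h⟩
    refine Waveguide.memDWG_of_exists_lintegral_lt_top hp hv hR0 fun f hf => ?_
    obtain ⟨z, hz⟩ := (h f hf).1.exists
    exact ⟨z, (Waveguide.heatConvFinite_iff hR0 hf.1 z).1 hz⟩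
  tfae_have 4 → 1 := by
    rintro ⟨R, hR0, -, h⟩
    refine Waveguide.memDWG_of_exists_lintegral_lt_top hp hv (half_pos hR0) fun f hf => ?_
    obtain ⟨z, hz⟩ := (h f hf).exists
    refine ⟨z, lt_top_iff_ne_top.2 fun htop => ?_⟩
    rw [Waveguide.heatMaximal_eq_top (half_pos hR0) (half_lt_self hR0) hf.1 htop] at hz
    exact lt_irrefl _ hz
  tfae_finish
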